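/- A $W^*$-algebra is a unital $C^*$-algebra that is, as a Banach space, the dual of a Banach space; morphisms of $W^*$-algebras are unital $w^*$-continuous $*$-homomorphisms, and $\overline{\otimes}$ denotes the spatial tensor product of $W^*$-algebras: the $W^*$-algebra of operators generated by the elementary tensors $m\otimes n$, the two algebras acting in their universal normal representations. The free product $\ast_\alpha \mathcal M_\alpha$ of a family of $W^*$-algebras is its coproduct in the category of $W^*$-algebras. A free exponential of $W^*$-algebras $\mathcal M$ and $\mathcal N$ is a $W^*$-algebra $\mathcal M^{\ast\mathcal N}$ with a morphism $\varepsilon:\mathcal M\to \mathcal M^{\ast\mathcal N}\,\overline{\otimes}\,\mathcal N$ such that for every $W^*$-algebra $\mathcal R$ and every morphism $\pi:\mathcal M\to\mathcal R\,\overline{\otimes}\,\mathcal N$ there is a unique morphism $\rho:\mathcal M^{\ast\mathcal N}\to\mathcal R$ with $\pi=(\rho\,\overline{\otimes}\,1)\circ\varepsilon$. For a morphism $f:\mathcal M\to\mathcal M'$, the induced morphism $f^{\ast\mathcal N}:\mathcal M^{\ast\mathcal N}\to\mathcal M'^{\ast\mathcal N}$ is the one with $(f^{\ast\mathcal N}\,\overline{\otimes}\,1)\circ\varepsilon=\varepsilon'\circ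 f$. Let $\{\mathcal M_\alpha\}$ be an indexed family of $W^*$-algebras with free product $\ast_\alpha\mathcal M_\alpha$ and inclusions $\iota_\beta:\mathcal M_\beta\to\ast_\alpha\mathcal M_\alpha$, let $\mathcal N$ be a $W^*$-algebra, and let $\mathcal M_\alpha^{\ast\mathcal N}$ be free exponentials. Then $$\Big(\mathop{\ast}_\alpha \mathcal M_\alpha\Big)^{\ast\mathcal N}\;\cong\;\mathop{\ast}_\alpha\mathcal M_\alpha^{\ast\mathcal N}.$$ More precisely: 1. for every free exponential $(\ast_\alpha\mathcal M_\alpha)^{\ast\mathcal N}$ and every free product $\ast_\alpha\mathcal M_\alpha^{\ast\mathcal N}$ with inclusions $\kappa_\beta$ there is exactly one isomorphism of $W^*$-algebras $\Phi:(\ast_\alpha\mathcal M_\alpha)^{\ast\mathcal N}\to\ast_\alpha\mathcal M_\alpha^{\ast\mathcal N}$ with $\Phi^{-1}\circ\kappa_\beta=\iota_\beta^{\ast\mathcal N}$ for all $\beta$; 2. every free exponential $(\ast_\alpha\mathcal M_\alpha)^{\ast\mathcal N}$, together with the induced morphisms $\iota_\beta^{\ast\mathcal N}$, is a free product of the $\mathcal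 M_\alpha^{\ast\mathcal N}$; 3. every free product $\mathcal Q$ of the $\mathcal M_\alpha^{\ast\mathcal N}$, with inclusions $\kappa_\beta$, is a free exponential of $\ast_\alpha\mathcal M_\alpha$ and $\mathcal N$ via some morphism $\delta:\ast_\alpha\mathcal M_\alpha\to\mathcal Q\,\overline{\otimes}\,\mathcal N$ with $\delta\circ\iota_\beta=(\kappa_\beta\,\overline{\otimes}\,1)\circ\varepsilon_\beta$ for all $\beta$. -/

import Mathlib

open CategoryTheory
open scoped InnerProductSpace TensorProduct ComplexOrder

universe u

namespace WStar

/-! ### `W*`-algebras and normal homomorphisms -/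

/-- The weak topology on `A` defined by a pairing `e` of `A` with `X`: pointwise convergence of
`e x` on `X`. -/
@[reducible]
noncomputable def weakTopology {A X : Type u} (e : A → X → ℂ) : TopologicalSpace A :=
  TopologicalSpace.induced e inferInstance

/-- A `W*`-algebra: a unital `C*`-algebra that is, as a Banach space, the dual of a Banach space,
its predual (which is unique). -/
structure WStarAlg : Type (u + 1) where
  /-- the underlying unital `C*`-algebra -/
  carrier : Type u
  /-- the predual -/
  Predual : Type u
  [cstar : CStarAlgebra carrier]
  [predualNormed : NormedAddCommGroup Predual]
  [predualSpace : NormedSpace ℂ Predual]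
  [predualComplete : CompleteSpace Predual]
  /-- the algebra is isometrically the dual of the predual -/
  dualEquiv : carrier ≃ₗᵢ[ℂ] StrongDual ℂ Predual

instance : CoeSort WStarAlg.{u} (Type u) := ⟨WStarAlg.carrier⟩

attribute [instance] WStarAlg.cstar WStarAlg.predualNormed WStarAlg.predualSpace
  WStarAlg.predualComplete

/-- The order of a `W*`-algebra: `x ≤ y` iff `y - x` is positive. -/
noncomputable instance (M : WStarAlg.{u}) : PartialOrder M := CStarAlgebra.spectralOrder M

instance (M : WStarAlg.{u}) : StarOrderedRing M := CStarAlgebra.spectralOrderedRing M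

/-- The `w*`-topology of a `W*`-algebra. -/
@[reducible]
noncomputable def WStarAlg.wstarTopology (M : WStarAlg.{u}) : TopologicalSpace M :=
  weakTopology fun (x : M) (p : M.Predual) => M.dualEquiv x p

/-- Unital normal (that is, `w*`-`w*`-continuous) `*`-homomorphisms. -/
structure Hom (M N : WStarAlg.{u}) where
  /-- the underlying unital `*`-homomorphism -/
  toStarAlgHom : M →⋆ₐ[ℂ] N
  normal : @Continuous M N M.wstarTopology N.wstarTopology toStarAlgHom

/-- The category of `W*`-algebras and unital normal `*`-homomorphisms. -/
noncomputable instance : LargeCategory WStarAlg.{u} where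
  Hom M N := Hom M N
  id M := ⟨StarAlgHom.id ℂ M, @continuous_id M M.wstarTopology⟩
  comp {M N R} f g := ⟨g.toStarAlgHom.comp f.toStarAlgHom,
    @Continuous.comp M N R M.wstarTopology N.wstarTopology R.wstarTopology _ _ g.normal f.normal⟩

noncomputable instance (M N : WStarAlg.{u}) : CoeFun (M ⟶ N) (fun _ => M → N) := ⟨fun f => f.toStarAlgHom⟩

/-! ### The `W*`-algebra generated by a set of operators -/

section Operators

variable (H : Type u) [NormedAddCommGroup H] [InnerProductSpace ℂ H] [CompleteSpace H]

/-- The vector functional `x ↦ ⟪η, x ξ⟫` on the bounded operators. -/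
noncomputable def vectorFunctional (ξ η : H) : StrongDual ℂ (H →L[ℂ] H) :=
  (innerSL ℂ η).comp (ContinuousLinearMap.apply ℂ H ξ)

/-- The predual of `B(H)`: the norm closure of the span of the vector functionals. The topology
it defines on `B(H)` is the ultraweak topology. -/
noncomputable def ultraweakDual : Submodule ℂ (StrongDual ℂ (H →L[ℂ] H)) :=
  (Submodule.span ℂ (Set.range fun p : H × H => vectorFunctional H p.1 p.2)).topologicalClosure

/-- The ultraweak topology on `B(H)`. -/
@[reducible]
noncomputable def ultraweakTopology : TopologicalSpace (H →L[ℂ] H) :=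
  weakTopology fun (x : H →L[ℂ] H) (ω : ultraweakDual H) => (ω : StrongDual ℂ (H →L[ℂ] H)) x

end Operators

/-- For a pairing `B` of `A` with `X`, a point is in the weak closure of a subspace iff every element
of `X` that vanishes on the subspace vanishes at the point. -/
theorem mem_closure_weakTopology {A X : Type u} [AddCommGroup A] [Module ℂ A] [AddCommGroup X]
    [Module ℂ X] (B : A →ₗ[ℂ] X →ₗ[ℂ] ℂ) (S : Submodule ℂ A) (x : A) :
    x ∈ @closure A (weakTopology fun a p => B a p) (S : Set A) ↔
      ∀ p : X, (∀ a ∈ S, B a p = 0) → B x p = 0 := by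
  have key : (weakTopology fun a p => B a p) =
      (inferInstance : TopologicalSpace (WeakBilin B)) := rfl
  rw [key]
  let S' : Submodule ℂ (WeakBilin B) := S
  constructor
  · intro hx p h0
    have hc : IsClosed {y : WeakBilin B | B y p = 0} :=
      isClosed_singleton.preimage (WeakBilin.eval_continuous B p)
    exact closure_minimal (s := (S' : Set (WeakBilin B))) h0 hc hx
  · intro h
    by_contra hx
    have hconv : Convex ℝ (closure (S' : Set (WeakBilin B))) :=
      (S'.topologicalClosure.restrictScalars ℝ).convex
    obtain ⟨f, s, hs, hsx⟩ := RCLike.geometric_hahn_banach_closed_point (𝕜 := ℂ) hconv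
      isClosed_closure hx
    obtain ⟨p, hp⟩ := LinearMap.dualEmbedding_surjective B f
    have hf : ∀ a : A, f a = B a p := fun a => by rw [← hp]; rfl
    have hz : ∀ a ∈ S, B a p = 0 := by
      intro a ha
      by_contra hne
      have hpos : 0 < ‖B a p‖ ^ 2 := by positivity
      have hb := hs ((((|s| + 1) / ‖B a p‖ ^ 2 : ℝ) : ℂ) • (star (B a p) • a))
        (subset_closure (S.smul_mem _ (S.smul_mem _ ha)))
      rw [hf, map_smul, map_smul, LinearMap.smul_apply, LinearMap.smul_apply, smul_eq_mul,
        smul_eq_mul, Complex.star_def,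
        ← Complex.normSq_eq_conj_mul_self, Complex.normSq_eq_norm_sq, ← Complex.ofReal_mul,
        div_mul_cancel₀ _ hpos.ne'] at hb
      have : |s| + 1 < s := by simpa using hb
      linarith [le_abs_self s]
    have h0 := hs 0 (subset_closure S'.zero_mem)
    have h1 := h p hz
    rw [hf, h1] at hsx
    simp at h0 hsx
    linarith

section Operators

variable {H : Type u} [NormedAddCommGroup H] [InnerProductSpace ℂ H] [CompleteSpace H]

set_option linter.unusedSectionVars false in
theorem vectorFunctional_mem (ξ η : H) : vectorFunctional H ξ η ∈ ultraweakDual H :=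
  Submodule.le_topologicalClosure _ (Submodule.subset_span ⟨(ξ, η), rfl⟩)

/-- Ultraweakly continuous functionals are stable under the maps induced by a bounded linear map
on operators that sends vector functionals to vector functionals. -/
theorem comp_mem_ultraweakDual (T : (H →L[ℂ] H) →L[ℂ] (H →L[ℂ] H))
    (hT : ∀ ξ η, ∃ ξ' η', (vectorFunctional H ξ η).comp T = vectorFunctional H ξ' η')
    {ω : StrongDual ℂ (H →L[ℂ] H)} (hω : ω ∈ ultraweakDual H) : ω.comp T ∈ ultraweakDual H := by
  have hcont : Continuous fun ω : StrongDual ℂ (H →L[ℂ] H) => ω.comp T := by fun_prop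
  have hcl : IsClosed {ω : StrongDual ℂ (H →L[ℂ] H) | ω.comp T ∈ ultraweakDual H} :=
    (Submodule.isClosed_topologicalClosure _).preimage hcont
  refine closure_minimal ?_ hcl hω
  intro ω hω
  induction hω using Submodule.span_induction with
  | mem x h =>
    obtain ⟨p, rfl⟩ := h
    obtain ⟨ξ', η', h⟩ := hT p.1 p.2
    simpa [h] using vectorFunctional_mem ξ' η'
  | zero => simp
  | add x y _ _ hx hy =>
    simpa [ContinuousLinearMap.add_comp] using Submodule.add_mem _ hx hy
  | smul c x _ hx =>
    simpa [ContinuousLinearMap.smul_comp] using Submodule.smul_mem _ c hx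

theorem comp_mul_left_mem {ω : StrongDual ℂ (H →L[ℂ] H)} (hω : ω ∈ ultraweakDual H)
    (a : H →L[ℂ] H) : ω.comp (ContinuousLinearMap.mul ℂ (H →L[ℂ] H) a) ∈ ultraweakDual H := by
  refine comp_mem_ultraweakDual _ (fun ξ η => ⟨ξ, star a η, ?_⟩) hω
  ext x
  simp [vectorFunctional, ContinuousLinearMap.star_eq_adjoint,
    ContinuousLinearMap.adjoint_inner_left]

theorem comp_mul_right_mem {ω : StrongDual ℂ (H →L[ℂ] H)} (hω : ω ∈ ultraweakDual H)
    (b : H →L[ℂ] H) :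
    ω.comp ((ContinuousLinearMap.mul ℂ (H →L[ℂ] H)).flip b) ∈ ultraweakDual H := by
  refine comp_mem_ultraweakDual _ (fun ξ η => ⟨b ξ, η, ?_⟩) hω
  ext x
  simp [vectorFunctional]

/-- The functional `x ↦ conj (ω (x*))`. -/
theorem exists_conj_mem {ω : StrongDual ℂ (H →L[ℂ] H)} (hω : ω ∈ ultraweakDual H) :
    ∃ ω' ∈ ultraweakDual H, ∀ x, ω' x = star (ω (star x)) := by
  let J : StrongDual ℂ (H →L[ℂ] H) → StrongDual ℂ (H →L[ℂ] H) := fun ω =>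
    ((starL ℂ : ℂ ≃L⋆[ℂ] ℂ) : ℂ →L⋆[ℂ] ℂ).comp
      (ω.comp ((starL ℂ : (H →L[ℂ] H) ≃L⋆[ℂ] (H →L[ℂ] H)) : (H →L[ℂ] H) →L⋆[ℂ] (H →L[ℂ] H)))
  have hJ : ∀ ω x, J ω x = star (ω (star x)) := fun _ _ => rfl
  have hcont : Continuous J := by
    refine (LipschitzWith.of_dist_le_mul (K := 1) fun ω₁ ω₂ => ?_).continuous
    rw [dist_eq_norm, NNReal.coe_one, one_mul, dist_eq_norm]
    refine ContinuousLinearMap.opNorm_le_bound _ (norm_nonneg _) fun x => ?_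
    rw [sub_apply, hJ, hJ, ← star_sub, norm_star, ← sub_apply]
    simpa using (ω₁ - ω₂).le_opNorm (star x)
  have hcl : IsClosed {ω : StrongDual ℂ (H →L[ℂ] H) | J ω ∈ ultraweakDual H} :=
    (Submodule.isClosed_topologicalClosure _).preimage hcont
  refine ⟨J ω, closure_minimal ?_ hcl hω, hJ ω⟩
  intro ω hω
  show J ω ∈ ultraweakDual H
  induction hω using Submodule.span_induction with
  | mem x h =>
    obtain ⟨p, rfl⟩ := h
    have : J (vectorFunctional H p.1 p.2) = vectorFunctional H p.2 p.1 := by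
      ext x
      rw [hJ]
      simp [vectorFunctional, ContinuousLinearMap.star_eq_adjoint,
        ContinuousLinearMap.adjoint_inner_right]
    simpa [this] using vectorFunctional_mem p.2 p.1
  | zero =>
    have : J 0 = 0 := by ext x; rw [hJ]; simp
    simp [this]
  | add x y _ _ hx hy =>
    have : J (x + y) = J x + J y := by ext z; simp [hJ]
    rw [this]; exact Submodule.add_mem _ hx hy
  | smul c x _ hx =>
    have : J (c • x) = star c • J x := by ext z; simp [hJ]
    rw [this]; exact Submodule.smul_mem _ _ hx

/-- Membership in the ultraweak closure of a `*`-subalgebra of `B(H)`. -/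
theorem mem_ultraweakClosure_iff (A : StarSubalgebra ℂ (H →L[ℂ] H)) (x : H →L[ℂ] H) :
    x ∈ @closure _ (ultraweakTopology H) (A : Set (H →L[ℂ] H)) ↔
      ∀ ω ∈ ultraweakDual H, (∀ a ∈ A, ω a = 0) → ω x = 0 :=
  (mem_closure_weakTopology (A := H →L[ℂ] H) (X := ultraweakDual H)
    (ContinuousLinearMap.coeLM ℂ ∘ₗ (ultraweakDual H).subtype).flip
    (Subalgebra.toSubmodule A.toSubalgebra) x).trans Subtype.forall

/-- The `W*`-subalgebra of `B(H)` generated by a set of operators: the ultraweak closure of the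
unital `*`-algebra that they generate. -/
noncomputable def wstarAdjoin (S : Set (H →L[ℂ] H)) : StarSubalgebra ℂ (H →L[ℂ] H) where
  carrier := @closure _ (ultraweakTopology H)
    (StarAlgebra.adjoin ℂ S : Set (H →L[ℂ] H))
  mul_mem' {x y} hx hy := by
    rw [mem_ultraweakClosure_iff] at *
    intro ω hω h
    refine hx _ (comp_mul_right_mem hω y) fun a ha => ?_
    refine hy _ (comp_mul_left_mem hω a) fun b hb => ?_
    exact h _ (mul_mem ha hb)
  add_mem' {x y} hx hy := by
    rw [mem_ultraweakClosure_iff] at *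
    intro ω hω h
    rw [map_add, hx ω hω h, hy ω hω h, add_zero]
  algebraMap_mem' r := by
    rw [mem_ultraweakClosure_iff]
    intro ω hω h
    exact h _ (algebraMap_mem _ r)
  star_mem' {x} hx := by
    rw [mem_ultraweakClosure_iff] at *
    intro ω hω h
    obtain ⟨ω', hω', h'⟩ := exists_conj_mem hω
    have := hx ω' hω' fun a ha => by rw [h', h _ (star_mem ha), star_zero]
    rw [h'] at this
    exact star_eq_zero.mp this

theorem mem_wstarAdjoin_iff (S : Set (H →L[ℂ] H)) (x : H →L[ℂ] H) :
    x ∈ wstarAdjoin S ↔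
      ∀ ω ∈ ultraweakDual H, (∀ a ∈ StarAlgebra.adjoin ℂ S, ω a = 0) → ω x = 0 :=
  mem_ultraweakClosure_iff _ x

theorem subset_wstarAdjoin (S : Set (H →L[ℂ] H)) : S ⊆ wstarAdjoin S := fun x hx => by
  rw [SetLike.mem_coe, mem_wstarAdjoin_iff]
  exact fun ω _ h => h _ (StarAlgebra.subset_adjoin ℂ S hx)

instance isClosed_wstarAdjoin (S : Set (H →L[ℂ] H)) :
    IsClosed (wstarAdjoin S : Set (H →L[ℂ] H)) := by
  have : (wstarAdjoin S : Set (H →L[ℂ] H)) =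
      ⋂ ω ∈ {ω | ω ∈ ultraweakDual H ∧ ∀ a ∈ StarAlgebra.adjoin ℂ S, ω a = 0},
        {x | ω x = 0} := by
    ext x
    simp [mem_wstarAdjoin_iff]
  rw [this]
  exact isClosed_biInter fun ω _ => isClosed_singleton.preimage ω.continuous

/-- The `W*`-subalgebra of `B(H)` generated by a set of operators, as a `C*`-algebra. -/
def GeneratedAlgebra (S : Set (H →L[ℂ] H)) : Type u := wstarAdjoin S

noncomputable instance (S : Set (H →L[ℂ] H)) : CStarAlgebra (GeneratedAlgebra S) :=
  inferInstanceAs (CStarAlgebra (wstarAdjoin S))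

/-- The operator underlying an element of a generated `W*`-subalgebra of `B(H)`. -/
noncomputable def GeneratedAlgebra.val (S : Set (H →L[ℂ] H)) :
    GeneratedAlgebra S →⋆ₐ[ℂ] (H →L[ℂ] H) :=
  (wstarAdjoin S).subtype

theorem GeneratedAlgebra.norm_val {S : Set (H →L[ℂ] H)} (x : GeneratedAlgebra S) :
    ‖GeneratedAlgebra.val S x‖ = ‖x‖ := rfl

/-- The inclusion of a generated `W*`-subalgebra into `B(H)` as an isometry. -/
noncomputable def GeneratedAlgebra.inclusion (S : Set (H →L[ℂ] H)) :
    GeneratedAlgebra S →ₗᵢ[ℂ] (H →L[ℂ] H) where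
  toLinearMap := (GeneratedAlgebra.val S).toAlgHom.toLinearMap
  norm_map' x := GeneratedAlgebra.norm_val x

/-- Restriction of functionals from `B(H)` to a generated `W*`-subalgebra. -/
noncomputable def restrictDual (S : Set (H →L[ℂ] H)) :
    StrongDual ℂ (H →L[ℂ] H) →L[ℂ] StrongDual ℂ (GeneratedAlgebra S) :=
  (ContinuousLinearMap.compL ℂ (GeneratedAlgebra S) (H →L[ℂ] H) ℂ).flip
    (GeneratedAlgebra.inclusion S).toContinuousLinearMap

theorem restrictDual_apply (S : Set (H →L[ℂ] H)) (ω : StrongDual ℂ (H →L[ℂ] H))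
    (x : GeneratedAlgebra S) : restrictDual S ω x = ω (GeneratedAlgebra.val S x) := rfl

theorem norm_restrictDual_le (S : Set (H →L[ℂ] H)) (ω : StrongDual ℂ (H →L[ℂ] H)) :
    ‖restrictDual S ω‖ ≤ ‖ω‖ :=
  ContinuousLinearMap.opNorm_le_bound _ (norm_nonneg _) fun x => ω.le_opNorm (GeneratedAlgebra.val S x)

/-- The ultraweakly continuous functionals on a generated `W*`-subalgebra of `B(H)`: the norm
closure of the restrictions of those on `B(H)`. -/
noncomputable def restrictedDual (S : Set (H →L[ℂ] H)) :
    Submodule ℂ (StrongDual ℂ (GeneratedAlgebra S)) :=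
  ((ultraweakDual H).map (restrictDual S).toLinearMap).topologicalClosure

theorem restrictDual_mem (S : Set (H →L[ℂ] H)) {ω : StrongDual ℂ (H →L[ℂ] H)}
    (hω : ω ∈ ultraweakDual H) : restrictDual S ω ∈ restrictedDual S :=
  Submodule.le_topologicalClosure _ (Submodule.mem_map_of_mem hω)

/-- The space of ultraweakly continuous functionals on a generated `W*`-subalgebra as a type. -/
def RestrictedPredual (S : Set (H →L[ℂ] H)) : Type u := restrictedDual S

noncomputable instance (S : Set (H →L[ℂ] H)) : NormedAddCommGroup (RestrictedPredual S) :=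
  inferInstanceAs (NormedAddCommGroup (restrictedDual S))

noncomputable instance (S : Set (H →L[ℂ] H)) : NormedSpace ℂ (RestrictedPredual S) :=
  inferInstanceAs (NormedSpace ℂ (restrictedDual S))

instance (S : Set (H →L[ℂ] H)) : CompleteSpace (RestrictedPredual S) :=
  (Submodule.isClosed_topologicalClosure _).completeSpace_coe

/-- The functional underlying an element of the predual. -/
noncomputable def RestrictedPredual.val {S : Set (H →L[ℂ] H)} :
    RestrictedPredual S →ₗᵢ[ℂ] StrongDual ℂ (GeneratedAlgebra S) where
  toFun p := p.1
  map_add' _ _ := rfl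
  map_smul' _ _ := rfl
  norm_map' _ := rfl

theorem norm_vectorFunctional_le (ξ η : H) : ‖vectorFunctional H ξ η‖ ≤ ‖ξ‖ * ‖η‖ := by
  refine ContinuousLinearMap.opNorm_le_bound _ (by positivity) fun x => ?_
  calc ‖⟪η, x ξ⟫_ℂ‖ ≤ ‖η‖ * ‖x ξ‖ := norm_inner_le_norm _ _
    _ ≤ ‖η‖ * (‖x‖ * ‖ξ‖) := by gcongr; exact x.le_opNorm ξ
    _ = _ := by ring

/-- Evaluation of ultraweakly continuous functionals at an element of the algebra. -/
noncomputable def evalAt {S : Set (H →L[ℂ] H)} (x : GeneratedAlgebra S) :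
    StrongDual ℂ (RestrictedPredual S) :=
  (ContinuousLinearMap.apply ℂ ℂ x).comp (RestrictedPredual.val (S := S)).toContinuousLinearMap

theorem evalAt_apply {S : Set (H →L[ℂ] H)} (x : GeneratedAlgebra S) (p : RestrictedPredual S) :
    evalAt x p = p.val x := rfl

theorem norm_evalAt_le {S : Set (H →L[ℂ] H)} (x : GeneratedAlgebra S) : ‖evalAt x‖ ≤ ‖x‖ := by
  refine ContinuousLinearMap.opNorm_le_bound _ (norm_nonneg _) fun p => ?_
  rw [mul_comm, ← RestrictedPredual.val.norm_map p]
  exact (RestrictedPredual.val p).le_opNorm x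

theorem le_norm_evalAt {S : Set (H →L[ℂ] H)} (x : GeneratedAlgebra S) :
    ‖x‖ ≤ ‖evalAt x‖ := by
  rw [← GeneratedAlgebra.norm_val]
  refine ContinuousLinearMap.opNorm_le_bound _ (norm_nonneg _) fun ξ => ?_
  rcases eq_or_ne (GeneratedAlgebra.val S x ξ) 0 with h0 | h0
  · rw [h0, norm_zero]; positivity
  refine le_of_mul_le_mul_right ?_ (norm_pos_iff.mpr h0)
  obtain ⟨p, hp, hval⟩ : ∃ p : RestrictedPredual S, ‖p‖ ≤ ‖ξ‖ * ‖GeneratedAlgebra.val S x ξ‖ ∧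
      evalAt x p = (‖GeneratedAlgebra.val S x ξ‖ : ℂ) ^ 2 :=
    ⟨⟨restrictDual S (vectorFunctional H ξ (GeneratedAlgebra.val S x ξ)),
      restrictDual_mem S (vectorFunctional_mem _ _)⟩,
      (norm_restrictDual_le S _).trans (norm_vectorFunctional_le _ _),
      inner_self_eq_norm_sq_to_K (𝕜 := ℂ) (GeneratedAlgebra.val S x ξ)⟩
  have hT : ‖evalAt x p‖ ≤ ‖evalAt x‖ * ‖p‖ := (evalAt x).le_opNorm p
  rw [hval, norm_pow, Complex.norm_real, norm_norm] at hT
  calc ‖GeneratedAlgebra.val S x ξ‖ * ‖GeneratedAlgebra.val S x ξ‖ = ‖GeneratedAlgebra.val S x ξ‖ ^ 2 := (sq _).symm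
    _ ≤ ‖evalAt x‖ * ‖p‖ := hT
    _ ≤ ‖evalAt x‖ * (‖ξ‖ * ‖GeneratedAlgebra.val S x ξ‖) := by gcongr
    _ = ‖evalAt x‖ * ‖ξ‖ * ‖GeneratedAlgebra.val S x ξ‖ := by ring

/-- The isometric embedding of a generated `W*`-subalgebra of `B(H)` into the dual of the space of
its ultraweakly continuous functionals. -/
noncomputable def evalRestricted (S : Set (H →L[ℂ] H)) :
    GeneratedAlgebra S →ₗᵢ[ℂ] StrongDual ℂ (RestrictedPredual S) where
  toFun := evalAt
  map_add' x y := by ext p; exact map_add p.val x y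
  map_smul' c x := by ext p; exact map_smul p.val c x
  norm_map' x := le_antisymm (norm_evalAt_le x) (le_norm_evalAt x)

theorem evalRestricted_apply (S : Set (H →L[ℂ] H)) (x : GeneratedAlgebra S) (p : RestrictedPredual S) :
    evalRestricted S x p = p.val x := rfl

/-- Every bounded functional on the predual of `B(H)` is evaluation at an operator. -/
theorem exists_operator (F : StrongDual ℂ (StrongDual ℂ (H →L[ℂ] H))) :
    ∃ x : H →L[ℂ] H, ∀ ω ∈ ultraweakDual H, F ω = ω x := by
  let b : H →L⋆[ℂ] H →L[ℂ] ℂ := LinearMap.mkContinuous₂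
    (LinearMap.mk₂'ₛₗ (starRingEnd ℂ) (RingHom.id ℂ) (fun η ξ => F (vectorFunctional H ξ η))
      (fun η η' ξ => by
        rw [← map_add]; congr 1; ext x; simp [vectorFunctional])
      (fun c η ξ => by
        rw [← map_smul]; congr 1; ext x; simp [vectorFunctional])
      (fun η ξ ξ' => by
        rw [← map_add]; congr 1; ext x; simp [vectorFunctional])
      (fun c η ξ => by
        rw [RingHom.id_apply, ← map_smul]; congr 1; ext x
        simp [vectorFunctional])) ‖F‖ fun η ξ => by
    calc ‖F (vectorFunctional H ξ η)‖ ≤ ‖F‖ * ‖vectorFunctional H ξ η‖ := F.le_opNorm _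
      _ ≤ ‖F‖ * (‖ξ‖ * ‖η‖) := by gcongr; exact norm_vectorFunctional_le ξ η
      _ = ‖F‖ * ‖η‖ * ‖ξ‖ := by ring
  have hb : ∀ η ξ, b η ξ = F (vectorFunctional H ξ η) := fun _ _ => rfl
  let y : H →L[ℂ] H := InnerProductSpace.continuousLinearMapOfBilin b
  refine ⟨star y, fun ω hω => ?_⟩
  have hcl : IsClosed {ω : StrongDual ℂ (H →L[ℂ] H) | F ω = ω (star y)} :=
    isClosed_eq F.continuous (ContinuousLinearMap.apply ℂ ℂ (star y)).continuous
  refine closure_minimal ?_ hcl hω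
  intro ω hω
  show F ω = ω (star y)
  induction hω using Submodule.span_induction with
  | mem x h =>
    obtain ⟨p, rfl⟩ := h
    rw [← hb]
    simp only [vectorFunctional, ContinuousLinearMap.comp_apply, ContinuousLinearMap.apply_apply,
      innerSL_apply_apply, ContinuousLinearMap.star_eq_adjoint,
      ContinuousLinearMap.adjoint_inner_right]
    exact (InnerProductSpace.continuousLinearMapOfBilin_apply b p.2 p.1).symm
  | zero => simp
  | add x y _ _ hx hy => simp [hx, hy]
  | smul c x _ hx => simp [hx]

theorem evalRestricted_surjective (S : Set (H →L[ℂ] H)) :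
    Function.Surjective (evalRestricted S) := by
  intro f
  obtain ⟨G, hG⟩ : ∃ G : StrongDual ℂ (StrongDual ℂ (GeneratedAlgebra S)),
      ∀ p : RestrictedPredual S, G p.val = f p := by
    obtain ⟨G, hG, -⟩ := exists_extension_norm_eq (restrictedDual S) f
    exact ⟨G, hG⟩
  obtain ⟨x, hx⟩ := exists_operator (G.comp (restrictDual S))
  have hxS : x ∈ wstarAdjoin S := by
    rw [mem_wstarAdjoin_iff]
    intro ω hω h
    rw [← hx ω hω]
    have h0 : restrictDual S ω = 0 := by
      ext a
      exact (mem_wstarAdjoin_iff S a.1).mp a.2 ω hω h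
    rw [ContinuousLinearMap.comp_apply, h0, map_zero]
  obtain ⟨z, hz⟩ : ∃ z : GeneratedAlgebra S, GeneratedAlgebra.val S z = x := ⟨⟨x, hxS⟩, rfl⟩
  refine ⟨z, ?_⟩
  ext p
  rw [evalRestricted_apply, ← hG]
  have hcl : IsClosed {q : StrongDual ℂ (GeneratedAlgebra S) | q z = G q} :=
    isClosed_eq (ContinuousLinearMap.apply ℂ ℂ z).continuous G.continuous
  refine closure_minimal ?_ hcl p.2
  rintro _ ⟨ω, hω, rfl⟩
  have h1 : restrictDual S ω z = ω x := by rw [restrictDual_apply, hz]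
  exact h1.trans (hx ω hω).symm

/-- The `W*`-subalgebra of `B(H)` generated by a set of operators, as a `W*`-algebra. -/
noncomputable def generated (S : Set (H →L[ℂ] H)) : WStarAlg.{u} where
  carrier := GeneratedAlgebra S
  Predual := RestrictedPredual S
  dualEquiv := LinearIsometryEquiv.ofSurjective (evalRestricted S) (evalRestricted_surjective S)

end Operators

/-! ### The universal normal representation -/

/-- Normal states: the positive functionals of value `1` at the unit that belong to the predual. -/
structure NormalState (M : WStarAlg.{u}) where
  /-- the underlying positive functional -/
  toPositive : M →ₚ[ℂ] ℂ
  map_one : toPositive 1 = 1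
  normal : ∃ p : M.Predual, ∀ x : M, toPositive x = M.dualEquiv x p

/-- The Hilbert space of the universal normal representation: the Hilbert sum of the
Gelfand-Naimark-Segal spaces of all normal states. -/
abbrev UniversalSpace (M : WStarAlg.{u}) : Type u :=
  lp (fun f : NormalState M => f.toPositive.GNS) 2

/-- The universal normal representation: the direct sum of the Gelfand-Naimark-Segal
representations of all normal states. -/
noncomputable def universalRep (M : WStarAlg.{u}) :
    M →⋆ₐ[ℂ] (UniversalSpace M →L[ℂ] UniversalSpace M) where
  toFun x := lp.mapCLM 2 (fun f : NormalState M => f.toPositive.gnsStarAlgHom x) (norm_nonneg x)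
    (fun f => NonUnitalStarAlgHom.norm_apply_le f.toPositive.gnsStarAlgHom x)
  map_one' := by ext; simp
  map_mul' _ _ := by ext; simp
  map_zero' := by ext; simp
  map_add' _ _ := by ext; simp
  commutes' r := by ext; simp [Algebra.algebraMap_eq_smul_one]
  map_star' x := by
    rw [ContinuousLinearMap.star_eq_adjoint, ContinuousLinearMap.eq_adjoint_iff]
    intro v w
    rw [lp.inner_eq_tsum, lp.inner_eq_tsum]
    refine tsum_congr fun f => ?_
    simp [map_star, ContinuousLinearMap.star_eq_adjoint, ContinuousLinearMap.adjoint_inner_left]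

theorem universalRep_apply (M : WStarAlg.{u}) (x : M) (v : UniversalSpace M) (f : NormalState M) :
    universalRep M x v f = f.toPositive.gnsStarAlgHom x (v f) := rfl

/-! ### The spatial tensor product -/

/-- The Hilbert space tensor product. -/
abbrev HilbertTensor (H K : Type u) [NormedAddCommGroup H] [InnerProductSpace ℂ H]
    [NormedAddCommGroup K] [InnerProductSpace ℂ K] : Type u :=
  UniformSpace.Completion (H ⊗[ℂ] K)

/-- The operator `a ⊗ b` on the Hilbert space tensor product, `ξ ⊗ η ↦ a ξ ⊗ b η`. -/
noncomputable def tensorOp {H K : Type u} [NormedAddCommGroup H] [InnerProductSpace ℂ H]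
    [NormedAddCommGroup K] [InnerProductSpace ℂ K] (a : H →L[ℂ] H) (b : K →L[ℂ] K) :
    HilbertTensor H K →L[ℂ] HilbertTensor H K :=
  (TensorProduct.mapL a b).completion

/-- The elementary operators `m ⊗ n` on the tensor product of the universal spaces. -/
noncomputable def elementary (M N : WStarAlg.{u}) (m : M) (n : N) :
    HilbertTensor (UniversalSpace M) (UniversalSpace N) →L[ℂ]
      HilbertTensor (UniversalSpace M) (UniversalSpace N) :=
  tensorOp (universalRep M m) (universalRep N n)

/-- The spatial tensor product of two `W*`-algebras: the `W*`-algebra of operators generated by the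
elementary tensors `m ⊗ n`, in the universal normal representations. -/
noncomputable def tensor (M N : WStarAlg.{u}) : WStarAlg.{u} :=
  generated (Set.range fun p : M × N => elementary M N p.1 p.2)

/-- The elementary tensor `m ⊗ n` as an element of the spatial tensor product. -/
noncomputable def tmul {M N : WStarAlg.{u}} (m : M) (n : N) : tensor M N :=
  (⟨elementary M N m n, subset_wstarAdjoin _ ⟨(m, n), rfl⟩⟩ :
    GeneratedAlgebra (Set.range fun p : M × N => elementary M N p.1 p.2))

/-- `T` is the tensor product of the morphisms `f` and `g`, that is, the morphism with
`m ⊗ n ↦ f m ⊗ g n`. -/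
def IsTensorHom {M M' N N' : WStarAlg.{u}} (f : M ⟶ M') (g : N ⟶ N')
    (T : tensor M N ⟶ tensor M' N') : Prop :=
  ∀ (m : M) (n : N), T (tmul m n) = tmul (f m) (g n)

/-! ### Free products and free exponentials -/

/-- `P` with the morphisms `ι a : M a ⟶ P` is a free product of the family `M`: a coproduct in the
category of `W*`-algebras. -/
def IsFreeProduct {I : Type u} (M : I → WStarAlg.{u}) (P : WStarAlg.{u}) (ι : ∀ a, M a ⟶ P) :
    Prop :=
  Nonempty (Limits.IsColimit (Limits.Cofan.mk P ι))

/-- `E` with `ε : M ⟶ E ⊗ N` is a free exponential of `M` and `N`: for every `W*`-algebra `R` and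
every morphism `π : M ⟶ R ⊗ N` there is a unique morphism `ρ : E ⟶ R` with `(ρ ⊗ 1) ∘ ε = π`. -/
def IsFreeExponential (M N E : WStarAlg.{u}) (ε : M ⟶ tensor E N) : Prop :=
  ∀ (R : WStarAlg.{u}) (π : M ⟶ tensor R N),
    ∃! ρ : E ⟶ R, ∃ T : tensor E N ⟶ tensor R N, IsTensorHom ρ (𝟙 N) T ∧ ε ≫ T = π

/-- `σ : E ⟶ E'` is the morphism induced on free exponentials by `f : M ⟶ M'`, that is,
`(σ ⊗ 1) ∘ ε = ε' ∘ f`. -/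
def IsFreeExponentialMap {M M' N E E' : WStarAlg.{u}} (ε : M ⟶ tensor E N)
    (ε' : M' ⟶ tensor E' N) (f : M ⟶ M') (σ : E ⟶ E') : Prop :=
  ∃ T : tensor E N ⟶ tensor E' N, IsTensorHom σ (𝟙 N) T ∧ ε ≫ T = f ≫ ε'

end WStar

namespace WStar

/-! Once `ρ ⊗ 1` is available as a functor of `ρ`, the statement is that a left adjoint preserves
coproducts: morphisms out of a free exponential of `P` into `R` are morphisms `P ⟶ R ⊗ N`, these are
families `M a ⟶ R ⊗ N`, and these are families `E a ⟶ R`. The two identifications are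
`IsFreeExponential.isFreeProduct` and `IsFreeProduct.isFreeExponential`.

The analytic content is `exists_isTensorHom`: for normal `f : M ⟶ M'` the assignment `m ⊗ n ↦ f m ⊗
n` extends to a normal homomorphism of the generated algebras. For a normal state `φ` of `M'` and `y
∈ M'`, the functional `x ↦ φ (y* f(x) y)` on `M` is positive and normal, so the GNS construction
gives an operator between the universal spaces that intertwines `x` with `f x` and takes the vector
of `y` as a value. The ranges of such intertwiners `W` are total, and so are those of `W ⊗ 1`. An
element `x` of the first generated algebra then acts on the second space by `∑ W h ↦ ∑ W (x h)`.
This is well defined and bounded because every `W* W'` commutes with the algebra, and normal because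
vector functionals at `W a`, `W' b` pull back to vector functionals.

Two facts about preduals support this. Normality of `φ (y* f(·) y)` needs multiplication to be
separately `w*`-continuous, which the definition by a Banach space predual does not contain; it
follows from an averaging argument in the style of Tomiyama (`eq_zero_of_norm_control`). Uniqueness
and normality on generated algebras need every normal functional to be the restriction of an
ultraweakly continuous one (`isClosed_map_restrictDual`). -/

section Multiplication

variable {A X : Type*} [CStarAlgebra A] [NormedAddCommGroup X] [NormedSpace ℂ X]

/-! ### Separate `w*`-continuity of the multiplication -/

/-- A Pythagorean inequality: `c x` and `d` have orthogonal ranges, so the cross terms of the square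
vanish. -/
theorem norm_mul_add_sq_le {c x d : A} (h : star c * d = 0) :
    ‖c * x + d‖ ^ 2 ≤ (‖c‖ * ‖x‖) ^ 2 + ‖d‖ ^ 2 := by
  have h' : star d * c = 0 := by simpa using congrArg star h
  have h1 : star (c * x + d) * (c * x + d) = star (c * x) * (c * x) + star d * d := by
    rw [star_add, star_mul, add_mul, mul_add, mul_add, mul_assoc (star x), mul_assoc (star x) (star c) d,
      h, ← mul_assoc (star d), h']
    simp
  rw [sq, ← CStarRing.norm_star_mul_self, h1]
  refine (norm_add_le _ _).trans ?_
  rw [CStarRing.norm_star_mul_self, CStarRing.norm_star_mul_self, ← sq, ← sq]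
  gcongr
  exact norm_mul_le _ _

/-! ### Vanishing of linear maps controlled by left multiplications -/

section Order

variable [PartialOrder A] [StarOrderedRing A] {Z : A →ₗ[ℂ] A} {r : ℝ}

/-- Tomiyama's trick. With `z = Z c` and `b = k z`, orthogonality of `c` and `b` bounds `‖z + l b‖²`
above by a constant plus `l² ‖b‖²`, while compression by `k` bounds it below by `(1 + l)² ‖b‖²`. The
linear term in `l` forces `b = 0`. -/
theorem mul_eq_zero_of_norm_control
    (hZ : ∀ c d K, (∀ x, ‖x‖ ≤ r → ‖c * x + d‖ ≤ K) → ‖Z c + d‖ ≤ K)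
    {k c : A} (hk : IsSelfAdjoint k) (hk1 : k * k ≤ k) (hc : k * c = 0) : k * Z c = 0 := by
  set z := Z c with hz
  set b := k * z with hb
  have hcb : star c * b = 0 := by
    have : star c * k = 0 := by simpa [hk.star_eq] using congrArg star hc
    rw [hb, ← mul_assoc, this, zero_mul]
  have up (l : ℝ) : ‖z + (l : ℂ) • b‖ ^ 2 ≤ (‖c‖ * r) ^ 2 + l ^ 2 * ‖b‖ ^ 2 := by
    have := hZ c ((l : ℂ) • b) (√((‖c‖ * r) ^ 2 + l ^ 2 * ‖b‖ ^ 2)) fun x hx => by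
      refine Real.le_sqrt_of_sq_le ((norm_mul_add_sq_le (by simp [hcb])).trans ?_)
      rw [norm_smul, mul_pow _ ‖b‖, Complex.norm_real, Real.norm_eq_abs, sq_abs]
      gcongr
    calc _ ≤ (√((‖c‖ * r) ^ 2 + l ^ 2 * ‖b‖ ^ 2)) ^ 2 := by gcongr
      _ = _ := Real.sq_sqrt (by positivity)
  -- Since `k² ≤ k`, the product `b* (z + l b) = z* k z + l b* b` dominates `(1 + l) b* b`.
  have low (l : ℝ) (hl : 0 ≤ l) : (1 + l) * ‖b‖ ^ 2 ≤ ‖b‖ * ‖z + (l : ℂ) • b‖ := by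
    have e1 : star b * b = star z * (k * k) * z := by
      rw [hb, star_mul, hk.star_eq]; simp only [mul_assoc]
    have e2 : star b * (z + (l : ℂ) • b) = star z * k * z + l • (star z * (k * k) * z) := by
      rw [mul_add, mul_smul_comm, e1, hb, star_mul, hk.star_eq, Complex.coe_smul]
    have le : (1 + l) • (star b * b) ≤ star b * (z + (l : ℂ) • b) := by
      rw [e2, e1, add_smul, one_smul]
      gcongr
      exact star_left_conjugate_le_conjugate hk1 z
    have := CStarAlgebra.norm_le_norm_of_nonneg_of_le
      (smul_nonneg (by positivity) (star_mul_self_nonneg b)) le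
    rw [norm_smul, Real.norm_of_nonneg (by positivity), CStarRing.norm_star_mul_self, ← sq] at this
    exact this.trans ((norm_mul_le _ _).trans (by rw [norm_star]))
  by_contra hne
  have hpos : 0 < ‖b‖ := norm_pos_iff.mpr hne
  have key (l : ℝ) (hl : 0 ≤ l) : (1 + 2 * l) * ‖b‖ ^ 2 ≤ (‖c‖ * r) ^ 2 := by
    have h1 : (1 + l) * ‖b‖ ≤ ‖z + (l : ℂ) • b‖ := by
      refine le_of_mul_le_mul_left ?_ hpos
      linarith [low l hl]
    have h2 : ((1 + l) * ‖b‖) ^ 2 ≤ ‖z + (l : ℂ) • b‖ ^ 2 := by gcongr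
    linarith [up l]
  -- For this `l` the left side of `key` is `‖b‖²` plus twice the right side.
  have := key ((‖c‖ * r) ^ 2 / ‖b‖ ^ 2) (by positivity)
  have e : (‖c‖ * r) ^ 2 / ‖b‖ ^ 2 * ‖b‖ ^ 2 = (‖c‖ * r) ^ 2 := by field_simp
  have hb2 : 0 < ‖b‖ ^ 2 := by positivity
  nlinarith [sq_nonneg (‖c‖ * r)]

/-- The part of `a` near `t` controls `Z a` near `t`. -/
theorem norm_cfc_mul_le
    (hZ : ∀ c d K, (∀ x, ‖x‖ ≤ r → ‖c * x + d‖ ≤ K) → ‖Z c + d‖ ≤ K) (h1 : Z 1 = 0)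
    {a : A} (ha : IsSelfAdjoint a) (t : ℝ) {δ : ℝ} (hδ : 0 < δ) :
    ‖cfc (fun s : ℝ => max 0 (1 - |s - t| / δ)) a * Z a‖ ≤ δ * r := by
  set k : ℝ → ℝ := fun s => max 0 (1 - |s - t| / δ) with hk
  set h : ℝ → ℝ := fun s => max (-δ) (min δ (s - t)) with hh
  have hkc : Continuous k := by fun_prop
  have hhc : Continuous h := by fun_prop
  have hk0 (s : ℝ) : 0 ≤ k s := le_max_left _ _
  have hk1 (s : ℝ) : k s ≤ 1 := max_le zero_le_one (sub_le_self _ (by positivity))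
  -- Modulo a scalar, which `Z` kills, `a` is a part vanishing within `δ` of `t`, hence annihilated
  -- by the bump `k`, plus a truncation `h` of norm at most `δ`.
  have hza : Z a = Z (cfc (fun s => s - t - h s) a) + Z (cfc h a) := by
    have e : cfc (fun s => s - t - h s) a + cfc h a = a - algebraMap ℝ A t := by
      rw [← cfc_add ..]
      have : (fun s => s - t - h s + h s) = fun s => s - t := by ext s; ring
      rw [this, cfc_sub .., cfc_id' ℝ a, cfc_const t a]
    rw [← map_add, e, map_sub, Algebra.algebraMap_eq_smul_one, ← Complex.coe_smul, map_smul, h1]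
    simp
  have h2 : cfc k a * Z (cfc (fun s => s - t - h s) a) = 0 := by
    refine mul_eq_zero_of_norm_control hZ (cfc_predicate k a) ?_ ?_
    · rw [← cfc_mul ..]
      exact cfc_mono fun s _ => by nlinarith [hk0 s, hk1 s]
    · rw [← cfc_mul .., ← cfc_zero ℝ a]
      refine cfc_congr fun s _ => ?_
      simp only [Pi.zero_apply, mul_eq_zero]
      by_cases hs : |s - t| ≤ δ
      · right
        rw [abs_le] at hs
        simp only [hh]
        rw [min_eq_right hs.2, max_eq_right hs.1, sub_self]
      · left
        push Not at hs
        exact max_eq_left (by rw [sub_nonpos, le_div_iff₀ hδ]; linarith)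
  rw [hza, mul_add, h2, zero_add]
  have n1 : ‖cfc k a‖ ≤ 1 := norm_cfc_le zero_le_one fun s _ => by
    rw [Real.norm_of_nonneg (hk0 s)]; exact hk1 s
  have n2 : ‖cfc h a‖ ≤ δ := norm_cfc_le hδ.le fun s _ => by
    rw [Real.norm_eq_abs, abs_le]
    exact ⟨le_max_left _ _, max_le (by linarith) (min_le_left _ _)⟩
  have n3 : ‖Z (cfc h a)‖ ≤ δ * r := by
    have := hZ (cfc h a) 0 (δ * r) fun x hx => by
      rw [add_zero]
      exact (norm_mul_le _ _).trans (by gcongr)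
    rwa [add_zero] at this
  calc _ ≤ ‖cfc k a‖ * ‖Z (cfc h a)‖ := norm_mul_le _ _
    _ ≤ 1 * (δ * r) := by gcongr
    _ = _ := one_mul _

/-- Localise on the spectrum: about `2n` bumps of width of order `1/n` have squares summing to at
least `1/4`, and each bump times `Z a` has norm `O(1/n)`. Hence `‖Z a‖²` is at most a sum of `O(n)`
terms of order `1/n²`. -/
theorem apply_eq_zero_of_isSelfAdjoint
    (hZ : ∀ c d K, (∀ x, ‖x‖ ≤ r → ‖c * x + d‖ ≤ K) → ‖Z c + d‖ ≤ K) (h1 : Z 1 = 0)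
    {a : A} (ha : IsSelfAdjoint a) : Z a = 0 := by
  -- The summand `1` only keeps the mesh `R / n` positive when `a = 0`.
  set R := ‖a‖ + 1 with hR
  have hRpos : 0 < R := by positivity
  set z := Z a with hz
  have key (n : ℕ) (hn : 0 < n) : ‖z‖ ^ 2 ≤ 48 * (R * r) ^ 2 / n := by
    have hn' : (0 : ℝ) < n := by exact_mod_cast hn
    have hn1 : (1 : ℝ) ≤ n := by exact_mod_cast hn
    set e : ℝ := R / n with he
    have hepos : 0 < e := by positivity
    set t : ℕ → ℝ := fun j => -R + j * e with ht
    set k : ℕ → ℝ → ℝ := fun j s => max 0 (1 - |s - t j| / (2 * e)) with hk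
    have hkc (j : ℕ) : Continuous (k j) := by fun_prop
    have hsa (j : ℕ) : IsSelfAdjoint (cfc (k j) a) := cfc_predicate _ a
    -- The nodes have spacing `e` and the bumps half-width `2e`, so each spectral point lies within
    -- `e` of a node, where the bump is at least `1/2`.
    have hsum : algebraMap ℝ A (1 / 4) ≤
        ∑ j ∈ Finset.range (2 * n + 1), cfc (k j) a * cfc (k j) a := by
      have : ∑ j ∈ Finset.range (2 * n + 1), cfc (k j) a * cfc (k j) a =
          cfc (∑ j ∈ Finset.range (2 * n + 1), fun s => k j s * k j s) a := by
        rw [cfc_sum _ _ _ (fun j _ => by fun_prop)]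
        exact Finset.sum_congr rfl fun j _ => (cfc_mul ..).symm
      rw [this]
      refine algebraMap_le_cfc _ _ _ (fun s hs => ?_) (by
        rw [Finset.sum_fn]
        fun_prop)
      have hsR : |s| ≤ R := by
        have := spectrum.norm_le_norm_mul_of_mem hs
        rcases subsingleton_or_nontrivial A with hA | hA
        · simp [spectrum.of_subsingleton] at hs
        simp only [CStarRing.norm_one, mul_one, Real.norm_eq_abs] at this
        linarith
      rw [abs_le] at hsR
      set j := ⌊(s + R) / e⌋₊ with hj
      have hpos : 0 ≤ (s + R) / e := div_nonneg (by linarith) hepos.le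
      have f1 := Nat.floor_le hpos
      have f2 := Nat.lt_floor_add_one ((s + R) / e)
      rw [← hj] at f1 f2
      rw [le_div_iff₀ hepos] at f1
      rw [div_lt_iff₀ hepos] at f2
      have hjn : j ∈ Finset.range (2 * n + 1) := by
        rw [Finset.mem_range, Nat.lt_succ_iff]
        have : (j : ℝ) ≤ 2 * n := by
          have : R = n * e := by rw [he]; field_simp
          refine le_of_mul_le_mul_right ?_ hepos
          linarith
        exact_mod_cast this
      have hkj : 1 / 2 ≤ k j s := by
        refine le_max_of_le_right ?_
        have h0 : |s - t j| ≤ e := by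
          rw [abs_le]; simp only [ht]; constructor <;> linarith
        have : |s - t j| / (2 * e) ≤ 1 / 2 := by rw [div_le_iff₀ (by positivity)]; linarith
        linarith
      rw [Finset.sum_apply]
      refine le_trans ?_ (Finset.single_le_sum (f := fun j => k j s * k j s)
        (fun i _ => mul_self_nonneg _) hjn)
      show 1 / 4 ≤ k j s * k j s
      nlinarith
    have hconj : (1 / 4 : ℝ) • (star z * z) ≤
        ∑ j ∈ Finset.range (2 * n + 1), star (cfc (k j) a * z) * (cfc (k j) a * z) := by
      have := star_left_conjugate_le_conjugate hsum z
      rw [Finset.mul_sum, Finset.sum_mul, Algebra.algebraMap_eq_smul_one, mul_smul_comm,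
        smul_mul_assoc, mul_one] at this
      refine this.trans_eq (Finset.sum_congr rfl fun j _ => ?_)
      rw [star_mul, (hsa j).star_eq]
      simp only [mul_assoc]
    have hnorm := CStarAlgebra.norm_le_norm_of_nonneg_of_le
      (smul_nonneg (by positivity) (star_mul_self_nonneg z)) hconj
    rw [norm_smul, CStarRing.norm_star_mul_self, ← sq] at hnorm
    have hb : ‖∑ j ∈ Finset.range (2 * n + 1), star (cfc (k j) a * z) * (cfc (k j) a * z)‖ ≤
        (2 * n + 1) * (2 * e * r) ^ 2 := by
      refine (norm_sum_le_of_le _ (n := fun _ => (2 * e * r) ^ 2) fun j _ => ?_).trans_eq ?_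
      · rw [CStarRing.norm_star_mul_self, ← sq]
        gcongr
        exact norm_cfc_mul_le hZ h1 ha (t j) (by positivity)
      · simp
    have : ‖(1 / 4 : ℝ)‖ = 1 / 4 := by norm_num
    rw [this] at hnorm
    calc ‖z‖ ^ 2 ≤ 4 * ((2 * n + 1) * (2 * e * r) ^ 2) := by linarith
      _ ≤ 4 * ((2 * n + n) * (2 * e * r) ^ 2) := by gcongr
      _ = 48 * (R * r) ^ 2 / n := by rw [he]; field_simp; ring
  have hlim : Filter.Tendsto (fun n : ℕ => 48 * (R * r) ^ 2 / (n : ℝ)) Filter.atTop (nhds 0) :=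
    tendsto_const_div_atTop_nhds_zero_nat _
  have : ‖z‖ ^ 2 ≤ 0 := ge_of_tendsto hlim
    ((Filter.eventually_gt_atTop 0).mono fun n hn => key n hn)
  exact norm_eq_zero.mp (pow_eq_zero_iff two_ne_zero |>.mp (le_antisymm this (sq_nonneg _)))

end Order

theorem eq_zero_of_norm_control {Z : A →ₗ[ℂ] A} {r : ℝ}
    (hZ : ∀ c d K, (∀ x, ‖x‖ ≤ r → ‖c * x + d‖ ≤ K) → ‖Z c + d‖ ≤ K) (h1 : Z 1 = 0) (a : A) :
    Z a = 0 := by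
  let := CStarAlgebra.spectralOrder A
  have := CStarAlgebra.spectralOrderedRing A
  rw [← realPart_add_I_smul_imaginaryPart a, map_add, map_smul,
    apply_eq_zero_of_isSelfAdjoint hZ h1 (realPart a).2,
    apply_eq_zero_of_isSelfAdjoint hZ h1 (imaginaryPart a).2, smul_zero, add_zero]

/-- A functional on the dual of `E` is interpolated at a point by an element of `E` of almost the
same norm. -/
theorem exists_apply_eq_of_norm_lt {E : Type*} [NormedAddCommGroup E] [NormedSpace ℂ E]
    (F : StrongDual ℂ (StrongDual ℂ E)) {r : ℝ} (hF : ‖F‖ < r) (q : StrongDual ℂ E) :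
    ∃ x : E, ‖x‖ ≤ r ∧ q x = F q := by
  have hr : 0 < r := (norm_nonneg F).trans_lt hF
  rcases eq_or_ne q 0 with rfl | hq
  · exact ⟨0, by simpa using hr.le, by simp⟩
  have hqpos : 0 < ‖q‖ := norm_pos_iff.mpr hq
  have hlt : ‖F q‖ / r < ‖q‖ := by
    rw [div_lt_iff₀ hr, mul_comm]
    exact (F.le_opNorm q).trans_lt (by gcongr)
  obtain ⟨y, hy1, hy⟩ := q.exists_lt_apply_of_lt_opNorm hlt
  have hqy : 0 < ‖q y‖ := (by positivity : 0 ≤ ‖F q‖ / r).trans_lt hy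
  refine ⟨(F q / q y) • y, ?_, ?_⟩
  · rw [norm_smul, norm_div]
    rw [div_lt_iff₀ hr] at hy
    calc ‖F q‖ / ‖q y‖ * ‖y‖ ≤ ‖F q‖ / ‖q y‖ * 1 := by gcongr
      _ ≤ r := by rw [mul_one, div_le_iff₀ hqy]; linarith
  · rw [map_smul, smul_eq_mul, div_mul_cancel₀ _ (norm_pos_iff.mp hqy)]

/-- A bounded functional that vanishes on a closed subspace, has norm at most `1` and takes the
value of the quotient norm at a given point. -/
theorem exists_functional_vanishing {E : Type*} [NormedAddCommGroup E] [NormedSpace ℂ E]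
    (Y : Submodule ℂ E) [IsClosed (Y : Set E)] (x : E) :
    ∃ F : StrongDual ℂ E, ‖F‖ ≤ 1 ∧ (∀ y ∈ Y, F y = 0) ∧ F x = ‖(Y.mkQ x : E ⧸ Y)‖ := by
  obtain ⟨g, hg, hgx⟩ := exists_dual_vector'' ℂ (Y.mkQ x)
  refine ⟨g.comp Y.mkQL, ?_, fun y hy => ?_, hgx⟩
  · refine ContinuousLinearMap.opNorm_le_bound _ zero_le_one fun y => ?_
    refine (g.le_opNorm _).trans ?_
    gcongr
    exact Submodule.Quotient.norm_mk_le (S := Y) y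
  · have : Y.mkQ y = 0 := by simpa using hy
    simp only [ContinuousLinearMap.comp_apply, Submodule.mkQL_apply, this, map_zero]

theorem mem_of_norm_mkQ_eq_zero {E : Type*} [NormedAddCommGroup E] [NormedSpace ℂ E]
    (Y : Submodule ℂ E) [IsClosed (Y : Set E)] {x : E} (h : ‖(Y.mkQ x : E ⧸ Y)‖ = 0) : x ∈ Y := by
  have := norm_eq_zero.mp h
  exact (Submodule.Quotient.mk_eq_zero Y).mp this

/-- An operator has closed range if its norm dominates the quotient norm modulo its kernel. -/
theorem isClosed_range_of_dual_bound {E G : Type*} [NormedAddCommGroup E] [NormedSpace ℂ E]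
    [CompleteSpace E] [NormedAddCommGroup G] [NormedSpace ℂ G] (g : E →L[ℂ] G)
    (hg : ∀ F : StrongDual ℂ E, ‖F‖ ≤ 1 → (∀ y, g y = 0 → F y = 0) → ∀ x, ‖F x‖ ≤ ‖g x‖) :
    IsClosed (Set.range g) := by
  let Y : Submodule ℂ E := g.toLinearMap.ker
  have hY : IsClosed (Y : Set E) := g.isClosed_ker
  let l : E ⧸ Y →ₗ[ℂ] G := Y.liftQ g.toLinearMap le_rfl
  have hl : Continuous l := continuous_quot_lift _ g.continuous
  have hanti : AntilipschitzWith 1 l := by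
    refine AddMonoidHomClass.antilipschitz_of_bound l fun q => ?_
    obtain ⟨x, rfl⟩ := Y.mkQ_surjective q
    obtain ⟨F, hF1, hF0, hFx⟩ := exists_functional_vanishing Y x
    rw [NNReal.coe_one, one_mul]
    refine le_trans ?_ (hg F hF1 hF0 x)
    rw [hFx]
    simp
  have hrange : Set.range l = Set.range g := by
    rw [← Y.mkQ_surjective.range_comp l]; rfl
  rw [← hrange]
  let l' : E ⧸ Y →L[ℂ] G := ⟨l, hl⟩
  exact hanti.isClosed_range l'.uniformContinuous

/-! ### Stability of the predual under multiplication -/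

variable (e : A ≃ₗᵢ[ℂ] StrongDual ℂ X)

/-- The embedding of a predual into the dual. -/
noncomputable def predualEmbedding : X →ₗᵢ[ℂ] StrongDual ℂ A where
  toFun p := (NormedSpace.inclusionInDoubleDual ℂ X p).comp
    (e.toContinuousLinearEquiv : A →L[ℂ] StrongDual ℂ X)
  map_add' p q := by ext; simp
  map_smul' c p := by ext; simp
  norm_map' p := (ContinuousLinearMap.opNorm_comp_linearIsometryEquiv _ e).trans
    ((NormedSpace.inclusionInDoubleDualLi ℂ (E := X)).norm_map p)

theorem predualEmbedding_apply (p : X) (x : A) : predualEmbedding e p x = e x p := rfl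

variable [CompleteSpace X]

instance isClosed_range_predualEmbedding :
    IsClosed ((predualEmbedding e).toLinearMap.range : Set (StrongDual ℂ A)) :=
  (predualEmbedding e).isometry.isClosedEmbedding.isClosed_range

/-- If `p(a ·)` were outside the predual, Hahn-Banach would give `F` in the bidual of `A` that kills
the predual but not `p(a ·)`. The map sending `c` to the restriction of `c F` to the predual, read
as an element of `A`, kills `1` and is controlled in norm by left multiplications, so it vanishes;
its value at `a` then contradicts the choice of `F`. -/
theorem exists_predual_mul_left (a : A) (p : X) : ∃ q : X, ∀ x : A, e x q = e (a * x) p := by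
  let L (c : A) : StrongDual ℂ A →L[ℂ] StrongDual ℂ A :=
    (ContinuousLinearMap.compL ℂ A A ℂ).flip (ContinuousLinearMap.mul ℂ A c)
  have hL (c : A) (ω : StrongDual ℂ A) (x : A) : L c ω x = ω (c * x) := rfl
  set J := predualEmbedding e with hJ
  obtain ⟨F, hF, hF0, hFa⟩ := exists_functional_vanishing J.toLinearMap.range (L a (J p))
  let Z : A →ₗ[ℂ] A :=
    { toFun := fun c => e.symm ((F.comp (L c)).comp J.toContinuousLinearMap)
      map_add' := fun c d => by
        rw [← map_add]; congr 1; ext q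
        simp only [ContinuousLinearMap.comp_apply, add_apply, ← map_add]
        congr 1; ext x; simp [hL, add_mul]
      map_smul' := fun c d => by
        rw [RingHom.id_apply, ← map_smul]; congr 1; ext q
        simp only [ContinuousLinearMap.comp_apply, smul_apply, ← map_smul]
        congr 1; ext x; simp [hL] }
  have hZ (c : A) (q : X) : e (Z c) q = F (L c (J q)) := by
    show e (e.symm _) q = _
    rw [e.apply_symm_apply]; rfl
  have hzero : Z a = 0 := by
    -- Any radius above `‖F‖ ≤ 1` would do: `F` is matched by an element of that norm at one
    -- functional at a time. The element may depend on `q`, since the norm of `Z c + d` is tested on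
    -- each `q` separately.
    refine eq_zero_of_norm_control (r := 2) (fun c d K hK => ?_) ?_ a
    · have hK0 : 0 ≤ K := (norm_nonneg _).trans (hK 0 (by simp))
      rw [← e.norm_map]
      refine ContinuousLinearMap.opNorm_le_bound _ hK0 fun q => ?_
      obtain ⟨x, hx, hFx⟩ := exists_apply_eq_of_norm_lt F (hF.trans_lt one_lt_two) (L c (J q))
      rw [map_add, add_apply, hZ, ← hFx, hL, hJ, predualEmbedding_apply,
        ← add_apply, ← map_add]
      refine ((e _).le_opNorm q).trans ?_
      rw [e.norm_map]
      gcongr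
      exact hK x hx
    · apply e.injective
      ext q
      have : L 1 (J q) = J q := by ext x; simp [hL]
      rw [hZ, this, map_zero, zero_apply]
      exact hF0 _ ⟨q, rfl⟩
  have h0 : F (L a (J p)) = 0 := by rw [← hZ, hzero]; simp
  rw [h0] at hFa
  have hmem : L a (J p) ∈ J.toLinearMap.range := by
    refine mem_of_norm_mkQ_eq_zero _ ?_
    exact_mod_cast hFa.symm
  obtain ⟨q, hq⟩ := hmem
  exact ⟨q, fun x => DFunLike.congr_fun hq x⟩

theorem exists_predual_mul_right (a : A) (p : X) : ∃ q : X, ∀ x : A, e x q = e (x * a) p := by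
  obtain ⟨q, hq⟩ := exists_predual_mul_left
    ((MulOpposite.opLinearIsometryEquiv ℂ (H := A)).symm.trans e) (MulOpposite.op a) p
  exact ⟨q, fun x => hq (MulOpposite.op x)⟩

theorem exists_predual_conj (y : A) (p : X) :
    ∃ q : X, ∀ x : A, e x q = e (star y * x * y) p := by
  obtain ⟨q, hq⟩ := exists_predual_mul_right e y p
  obtain ⟨q', hq'⟩ := exists_predual_mul_left e (star y) q
  exact ⟨q', fun x => by rw [hq', hq]⟩

end Multiplication

/-! ### Normal homomorphisms and preduals -/

/-- Continuity is tested after pairing with each `y`, and the functionals continuous for a weak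
topology are exactly those given by elements of `X`. -/
theorem continuous_weakTopology_iff {A X B Y : Type u} [AddCommGroup A] [Module ℂ A]
    [AddCommGroup X] [Module ℂ X] (e : A →ₗ[ℂ] X →ₗ[ℂ] ℂ) (e' : B → Y → ℂ) (f : A → B)
    (hadd : ∀ y a b, e' (f (a + b)) y = e' (f a) y + e' (f b) y)
    (hsmul : ∀ y (c : ℂ) a, e' (f (c • a)) y = c * e' (f a) y) :
    @Continuous A B (weakTopology fun a x => e a x) (weakTopology e') f ↔
      ∀ y, ∃ x, ∀ a, e' (f a) y = e a x := by
  have key : (weakTopology fun a p => e a p) =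
      (inferInstance : TopologicalSpace (WeakBilin e)) := rfl
  rw [key]
  let f' : WeakBilin e → B := f
  let : TopologicalSpace B := weakTopology e'
  show Continuous f' ↔ _
  rw [continuous_induced_rng, continuous_pi_iff]
  refine forall_congr' fun y => ⟨fun h => ?_, fun ⟨x, hx⟩ => ?_⟩
  · let g : StrongDual ℂ (WeakBilin e) :=
      { toFun := fun a => e' (f a) y
        map_add' := hadd y
        map_smul' := hsmul y
        cont := h }
    obtain ⟨p, hp⟩ := LinearMap.dualEmbedding_surjective e g
    exact ⟨p, fun a => (DFunLike.congr_fun hp a).symm⟩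
  · have : (fun a => e' (f' a) y) = fun a : WeakBilin e => e a x := funext hx
    exact this ▸ WeakBilin.eval_continuous e x

/-- The pairing of a `W*`-algebra with its predual. -/
noncomputable def WStarAlg.pairing (M : WStarAlg.{u}) : M →ₗ[ℂ] M.Predual →ₗ[ℂ] ℂ :=
  ContinuousLinearMap.coeLM ℂ ∘ₗ M.dualEquiv.toLinearEquiv.toLinearMap

theorem normal_iff {M N : WStarAlg.{u}} (f : M →⋆ₐ[ℂ] N) :
    @Continuous M N M.wstarTopology N.wstarTopology f ↔
      ∀ p : N.Predual, ∃ q : M.Predual, ∀ x, N.dualEquiv (f x) p = M.dualEquiv x q :=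
  continuous_weakTopology_iff M.pairing _ f (fun y a b => by simp) (fun y c a => by simp)

/-! ### Normal functionals on generated algebras as restrictions from `B(H)` -/

section Operators

variable {H : Type u} [NormedAddCommGroup H] [InnerProductSpace ℂ H] [CompleteSpace H]

theorem exists_operator_norm_le (F : StrongDual ℂ (StrongDual ℂ (H →L[ℂ] H))) :
    ∃ x : H →L[ℂ] H, ‖x‖ ≤ ‖F‖ ∧ ∀ ω ∈ ultraweakDual H, F ω = ω x := by
  obtain ⟨x, hx⟩ := exists_operator F
  refine ⟨x, ContinuousLinearMap.opNorm_le_bound _ (norm_nonneg F) fun ξ => ?_, hx⟩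
  rcases eq_or_ne (x ξ) 0 with h0 | h0
  · rw [h0, norm_zero]; positivity
  refine le_of_mul_le_mul_right ?_ (norm_pos_iff.mpr h0)
  have h : F (vectorFunctional H ξ (x ξ)) = (‖x ξ‖ : ℂ) ^ 2 :=
    (hx _ (vectorFunctional_mem _ _)).trans (inner_self_eq_norm_sq_to_K (𝕜 := ℂ) (x ξ))
  have h' := F.le_opNorm (vectorFunctional H ξ (x ξ))
  rw [h, norm_pow, Complex.norm_real, norm_norm] at h'
  calc ‖x ξ‖ * ‖x ξ‖ = ‖x ξ‖ ^ 2 := (sq _).symm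
    _ ≤ ‖F‖ * (‖ξ‖ * ‖x ξ‖) := h'.trans (by gcongr; exact norm_vectorFunctional_le _ _)
    _ = _ := by ring

/-- The restrictions of the ultraweakly continuous functionals to a generated `W*`-subalgebra are
already norm closed. -/
theorem isClosed_map_restrictDual (S : Set (H →L[ℂ] H)) :
    IsClosed ((ultraweakDual H).map (restrictDual S).toLinearMap :
      Set (StrongDual ℂ (GeneratedAlgebra S))) := by
  let g : ultraweakDual H →L[ℂ] StrongDual ℂ (GeneratedAlgebra S) :=
    (restrictDual S).comp (ultraweakDual H).subtypeL
  have : CompleteSpace (ultraweakDual H) :=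
    (Submodule.isClosed_topologicalClosure _).completeSpace_coe
  have hrange : Set.range g =
      ((ultraweakDual H).map (restrictDual S).toLinearMap : Set _) := by
    ext p
    exact ⟨fun ⟨ω, h⟩ => ⟨ω, ω.2, h⟩, fun ⟨ω, hω, h⟩ => ⟨⟨ω, hω⟩, h⟩⟩
  rw [← hrange]
  refine isClosed_range_of_dual_bound (E := ultraweakDual H)
    (G := StrongDual ℂ (GeneratedAlgebra S)) g fun F hF1 hF0 ω => ?_
  obtain ⟨G, hG, hGF⟩ := exists_extension_norm_eq (ultraweakDual H) F
  obtain ⟨x, hx1, hx⟩ := exists_operator_norm_le G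
  -- Bipolar argument: `F` kills the normal functionals vanishing on the algebra, so the operator
  -- representing `F` lies in the algebra. Hence `F ω` is a value of the restriction of `ω` on the
  -- unit ball.
  have hxS : x ∈ wstarAdjoin S := by
    rw [mem_wstarAdjoin_iff]
    intro ω' hω' h
    rw [← hx ω' hω', hG ⟨ω', hω'⟩]
    refine hF0 _ ?_
    ext a
    exact (mem_wstarAdjoin_iff S a.1).mp a.2 ω' hω' h
  let z : GeneratedAlgebra S := ⟨x, hxS⟩
  have hz : ‖z‖ ≤ 1 := hx1.trans (hGF.trans_le hF1)
  have hval : g ω z = F ω := ((hx ω ω.2).symm.trans (hG ω) :)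
  rw [← hval]
  exact ((g ω).le_opNorm_of_le hz).trans_eq (mul_one _)

theorem exists_restrictDual_eq {S : Set (H →L[ℂ] H)} {p : StrongDual ℂ (GeneratedAlgebra S)}
    (hp : p ∈ restrictedDual S) : ∃ ω ∈ ultraweakDual H, restrictDual S ω = p := by
  have := (isClosed_map_restrictDual S).closure_eq.subset hp
  exact this

/-- A norm limit of restrictions would not visibly vanish on the ultraweak closure; a functional
that extends to an ultraweakly continuous one does. -/
theorem eq_zero_of_vanish_adjoin {S : Set (H →L[ℂ] H)} {p : StrongDual ℂ (GeneratedAlgebra S)}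
    (hp : p ∈ restrictedDual S)
    (h : ∀ x, GeneratedAlgebra.val S x ∈ StarAlgebra.adjoin ℂ S → p x = 0) : p = 0 := by
  obtain ⟨ω, hω, rfl⟩ := exists_restrictDual_eq hp
  ext x
  refine (mem_wstarAdjoin_iff S x.1).mp x.2 ω hω fun a ha => ?_
  exact h ⟨a, @subset_closure _ (ultraweakTopology H) _ _ ha⟩ ha

/-- An element of the generated `*`-algebra belongs to every `*`-subalgebra that contains the
generators. -/
theorem mem_of_val_mem_adjoin {S : Set (H →L[ℂ] H)} (B : StarSubalgebra ℂ (GeneratedAlgebra S))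
    (hB : ∀ x, GeneratedAlgebra.val S x ∈ S → x ∈ B) {x : GeneratedAlgebra S}
    (hx : GeneratedAlgebra.val S x ∈ StarAlgebra.adjoin ℂ S) : x ∈ B := by
  have h : StarAlgebra.adjoin ℂ S ≤ B.map (GeneratedAlgebra.val S) :=
    StarAlgebra.adjoin_le fun a ha =>
      ⟨⟨a, subset_wstarAdjoin S ha⟩, hB ⟨a, subset_wstarAdjoin S ha⟩ ha, rfl⟩
  obtain ⟨y, hy, hyx⟩ := h hx
  have : y = x := Subtype.ext hyx
  exact this ▸ hy

/-- Morphisms from a generated `W*`-algebra are determined by their values at the generators. -/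
theorem generated_hom_ext {S : Set (H →L[ℂ] H)} {R : WStarAlg.{u}} {T T' : generated S ⟶ R}
    (h : ∀ x : GeneratedAlgebra S, GeneratedAlgebra.val S x ∈ S → T x = T' x) : T = T' := by
  have hx (x : GeneratedAlgebra S) : T x = T' x := by
    refine R.dualEquiv.injective (ContinuousLinearMap.ext fun p => ?_)
    obtain ⟨q, hq⟩ := (normal_iff T.toStarAlgHom).mp T.normal p
    obtain ⟨q', hq'⟩ := (normal_iff T'.toStarAlgHom).mp T'.normal p
    have h0 : q.1 - q'.1 = 0 := by
      refine eq_zero_of_vanish_adjoin (Submodule.sub_mem _ q.2 q'.2) fun y hy => ?_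
      have hT : T y = T' y := mem_of_val_mem_adjoin
        (StarAlgHom.equalizer T.toStarAlgHom T'.toStarAlgHom) h hy
      have h1 : R.dualEquiv (T y) p = q.1 y := hq y
      have h2 : R.dualEquiv (T' y) p = q'.1 y := hq' y
      rw [sub_apply, ← h1, ← h2, hT, sub_self]
    have hqq : q = q' := Subtype.ext (sub_eq_zero.mp h0)
    rw [hq x, hq' x, hqq]
  obtain ⟨T, hT⟩ := T
  obtain ⟨T', hT'⟩ := T'
  congr 1
  exact StarAlgHom.ext hx

end Operators

/-! ### Homomorphisms of generated algebras from intertwiners -/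

section Amplify

variable {H : Type*} [NormedAddCommGroup H] [InnerProductSpace ℂ H]

/-- The componentwise action of operators. -/
noncomputable def amplify (L : Type*) (x : H →L[ℂ] H) : (L →₀ H) →ₗ[ℂ] (L →₀ H) :=
  Finsupp.mapRange.linearMap x.toLinearMap

theorem amplify_single {L : Type*} (x : H →L[ℂ] H) (l : L) (h : H) :
    amplify L x (Finsupp.single l h) = Finsupp.single l (x h) := by
  simp [amplify]

theorem amplify_mul {L : Type*} (x y : H →L[ℂ] H) (φ : L →₀ H) :
    amplify L (x * y) φ = amplify L x (amplify L y φ) := by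
  ext l; simp [amplify]

theorem amplify_add {L : Type*} (x y : H →L[ℂ] H) (φ : L →₀ H) :
    amplify L (x + y) φ = amplify L x φ + amplify L y φ := by
  ext l; simp [amplify]

theorem amplify_smul {L : Type*} (c : ℂ) (x : H →L[ℂ] H) (φ : L →₀ H) :
    amplify L (c • x) φ = c • amplify L x φ := by
  ext l; simp [amplify]

theorem amplify_one {L : Type*} (φ : L →₀ H) : amplify L (1 : H →L[ℂ] H) φ = φ := by
  ext l; simp [amplify]

end Amplify

section Intertwiners

variable {H K : Type u} [NormedAddCommGroup H] [InnerProductSpace ℂ H] [CompleteSpace H]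
  [NormedAddCommGroup K] [InnerProductSpace ℂ K] [CompleteSpace K]

/-- The matrix coefficients of `c x - x c` are ultraweakly continuous in `x` and vanish on the
generated `*`-algebra. -/
theorem commute_of_mem_wstarAdjoin {S : Set (H →L[ℂ] H)} {c : H →L[ℂ] H}
    (hc : ∀ a ∈ S, c * a = a * c) (hc' : ∀ a ∈ S, c * star a = star a * c) {x : H →L[ℂ] H}
    (hx : x ∈ wstarAdjoin S) : c * x = x * c := by
  have hadj : ∀ a ∈ StarAlgebra.adjoin ℂ S, c * a = a * c := by
    intro a ha
    induction ha using StarAlgebra.adjoin_induction with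
    | mem a h => exact hc a h
    | algebraMap r => exact (Algebra.commutes r c).symm
    | add a b _ _ ha hb => rw [mul_add, ha, hb, add_mul]
    | mul a b _ _ ha hb => rw [← mul_assoc, ha, mul_assoc, hb, mul_assoc]
    -- Since `c` need not be self-adjoint, `ih` says nothing about `star a`; the induction is rerun
    -- for `a` and `star a` together.
    | star a h ih =>
      refine StarAlgebra.adjoin_induction (s := S)
        (p := fun a _ => c * a = a * c ∧ c * star a = star a * c)
        (fun a h => ⟨hc a h, hc' a h⟩) (fun r => ?_) (fun a b _ _ ha hb => ?_)
        (fun a b _ _ ha hb => ?_) (fun a _ h => ?_) h |>.2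
      · rw [← algebraMap_star_comm]
        exact ⟨(Algebra.commutes r c).symm, (Algebra.commutes _ c).symm⟩
      · simp only [star_add, mul_add, add_mul, ha, hb, and_self]
      · rw [star_mul]
        exact ⟨by rw [← mul_assoc, ha.1, mul_assoc, hb.1, mul_assoc],
          by rw [← mul_assoc, hb.2, mul_assoc, ha.2, mul_assoc]⟩
      · rw [star_star]; exact h.symm
  ext ξ
  refine ext_inner_left ℂ fun η => ?_
  have h := (mem_wstarAdjoin_iff S x).mp hx
    ((vectorFunctional H ξ η).comp (ContinuousLinearMap.mul ℂ (H →L[ℂ] H) c) -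
      (vectorFunctional H ξ η).comp ((ContinuousLinearMap.mul ℂ (H →L[ℂ] H)).flip c))
    (Submodule.sub_mem _ (comp_mul_left_mem (vectorFunctional_mem _ _) c)
      (comp_mul_right_mem (vectorFunctional_mem _ _) c))
    (fun a ha => by
      have := hadj a ha
      simp [this])
  exact sub_eq_zero.mp h

variable {J : Type*} (s : J → H →L[ℂ] H) (s' : J → K →L[ℂ] K)

/-- The bounded operators that intertwine two families of operators and their adjoints. -/
abbrev Intertwiner : Type u :=
  {W : H →L[ℂ] K // ∀ j, W ∘L s j = s' j ∘L W ∧ W ∘L star (s j) = star (s' j) ∘L W}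

variable {s s'}

theorem Intertwiner.adjoint_comp_commute (W W' : Intertwiner s s') {x : H →L[ℂ] H}
    (hx : x ∈ wstarAdjoin (Set.range s)) (h : H) :
    (W.1.adjoint ∘L W'.1) (x h) = x ((W.1.adjoint ∘L W'.1) h) := by
  have key (V : Intertwiner s s') (j : J) :
      V.1.adjoint ∘L s' j = s j ∘L V.1.adjoint ∧
        V.1.adjoint ∘L star (s' j) = star (s j) ∘L V.1.adjoint := by
    have h1 := congrArg ContinuousLinearMap.adjoint (V.2 j).1
    have h2 := congrArg ContinuousLinearMap.adjoint (V.2 j).2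
    rw [ContinuousLinearMap.adjoint_comp, ContinuousLinearMap.adjoint_comp] at h1 h2
    simp only [ContinuousLinearMap.star_eq_adjoint, ContinuousLinearMap.adjoint_adjoint] at *
    exact ⟨h2.symm, h1.symm⟩
  have := commute_of_mem_wstarAdjoin (c := W.1.adjoint ∘L W'.1) (S := Set.range s)
    (by
      rintro _ ⟨j, rfl⟩
      rw [ContinuousLinearMap.mul_def, ContinuousLinearMap.mul_def, ContinuousLinearMap.comp_assoc,
        (W'.2 j).1, ← ContinuousLinearMap.comp_assoc, (key W j).1, ContinuousLinearMap.comp_assoc])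
    (by
      rintro _ ⟨j, rfl⟩
      rw [ContinuousLinearMap.mul_def, ContinuousLinearMap.mul_def, ContinuousLinearMap.comp_assoc,
        (W'.2 j).2, ← ContinuousLinearMap.comp_assoc, (key W j).2, ContinuousLinearMap.comp_assoc])
    hx
  exact DFunLike.congr_fun this h

variable (s s') in
/-- The sum of the values of intertwiners. -/
noncomputable def intertwinerSum : (Intertwiner s s' →₀ H) →ₗ[ℂ] K :=
  Finsupp.lsum ℂ fun W => W.1.toLinearMap

theorem intertwinerSum_single (W : Intertwiner s s') (h : H) :
    intertwinerSum s s' (Finsupp.single W h) = W.1 h := by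
  simp [intertwinerSum]

/-- The inner product of `W a` and `W' b` is that of `a` and `W* W' b`, and `x` moves across because
it commutes with `W* W'`. -/
theorem inner_amplify {x : H →L[ℂ] H} (hx : x ∈ wstarAdjoin (Set.range s))
    (φ ψ : Intertwiner s s' →₀ H) :
    ⟪intertwinerSum s s' (amplify _ (star x) φ), intertwinerSum s s' ψ⟫_ℂ =
      ⟪intertwinerSum s s' φ, intertwinerSum s s' (amplify _ x ψ)⟫_ℂ := by
  induction φ using Finsupp.induction_linear with
  | zero => simp
  | add φ φ' h h' => simp only [map_add, inner_add_left, h, h']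
  | single W a =>
    induction ψ using Finsupp.induction_linear with
    | zero => simp
    | add ψ ψ' h h' => simp only [map_add, inner_add_right, h, h']
    | single W' b =>
      rw [amplify_single, amplify_single]
      simp only [intertwinerSum_single]
      have := W.adjoint_comp_commute W' hx b
      simp only [ContinuousLinearMap.comp_apply] at this
      rw [← ContinuousLinearMap.adjoint_inner_right W.1 a (W'.1 (x b)), this,
        ContinuousLinearMap.star_eq_adjoint, ← ContinuousLinearMap.adjoint_inner_right W.1,
        ContinuousLinearMap.adjoint_inner_left]

theorem GeneratedAlgebra.val_mem {S : Set (H →L[ℂ] H)} (x : GeneratedAlgebra S) :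
    GeneratedAlgebra.val S x ∈ wstarAdjoin S := x.2

/-- Writing `‖x‖² - x* x = y* y` and applying `inner_amplify` turns `‖x‖² ‖v‖²`, for `v` the sum of
`φ`, into the squared norms obtained from `x` and `y`. In particular families with sum zero are
preserved, which makes `transfer` well defined. -/
theorem norm_intertwinerSum_amplify_le (x : GeneratedAlgebra (Set.range s))
    (φ : Intertwiner s s' →₀ H) :
    ‖intertwinerSum s s' (amplify _ (GeneratedAlgebra.val _ x) φ)‖ ≤
      ‖x‖ * ‖intertwinerSum s s' φ‖ := by
  let := CStarAlgebra.spectralOrder (GeneratedAlgebra (Set.range s))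
  have := CStarAlgebra.spectralOrderedRing (GeneratedAlgebra (Set.range s))
  have hnn : 0 ≤ algebraMap ℝ (GeneratedAlgebra (Set.range s)) (‖x‖ ^ 2) - star x * x :=
    sub_nonneg.mpr CStarAlgebra.star_mul_le_algebraMap_norm_sq
  obtain ⟨y, hy⟩ := CStarAlgebra.nonneg_iff_eq_star_mul_self.mp hnn
  have sq_eq (z : GeneratedAlgebra (Set.range s)) :
      ⟪intertwinerSum s s' φ,
          intertwinerSum s s' (amplify _ (GeneratedAlgebra.val _ (star z * z)) φ)⟫_ℂ =
        ((‖intertwinerSum s s' (amplify _ (GeneratedAlgebra.val _ z) φ)‖ ^ 2 : ℝ) : ℂ) := by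
    rw [map_mul, amplify_mul, ← inner_amplify (star z).val_mem, map_star, star_star,
      inner_self_eq_norm_sq_to_K]
    norm_cast
  have hsum : algebraMap ℝ (GeneratedAlgebra (Set.range s)) (‖x‖ ^ 2) =
      star y * y + star x * x := by rw [← hy, sub_add_cancel]
  have hval : ((‖x‖ ^ 2 : ℝ) : ℂ) • (1 : H →L[ℂ] H) =
      GeneratedAlgebra.val _ (star y * y) + GeneratedAlgebra.val _ (star x * x) := by
    rw [← map_add, ← hsum, Algebra.algebraMap_eq_smul_one, ← Complex.coe_smul, map_smul, map_one]
  have h := congrArg (fun a => ⟪intertwinerSum s s' φ, intertwinerSum s s' (amplify _ a φ)⟫_ℂ) hval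
  simp only [amplify_add, amplify_smul, amplify_one, map_add, map_smul, inner_add_right,
    inner_smul_right, sq_eq, inner_self_eq_norm_sq_to_K] at h
  have h' : ‖x‖ ^ 2 * ‖intertwinerSum s s' φ‖ ^ 2 =
      ‖intertwinerSum s s' (amplify _ (GeneratedAlgebra.val _ y) φ)‖ ^ 2 +
        ‖intertwinerSum s s' (amplify _ (GeneratedAlgebra.val _ x) φ)‖ ^ 2 := by
    rw [RCLike.ofReal_eq_complex_ofReal] at h
    exact_mod_cast h
  refine le_of_sq_le_sq ?_ (by positivity)
  rw [mul_pow, h']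
  exact le_add_of_nonneg_left (sq_nonneg _)

/-! ### The induced normal homomorphism -/

section Transfer

variable (s') in
/-- The operator on `K` that is determined by an operator on `H` and the intertwiners. -/
noncomputable def transfer (x : GeneratedAlgebra (Set.range s)) : K →L[ℂ] K :=
  (intertwinerSum s s' ∘ₗ amplify _ (GeneratedAlgebra.val _ x)).extendOfNorm (intertwinerSum s s')

theorem transfer_apply (hd : DenseRange (intertwinerSum s s'))
    (x : GeneratedAlgebra (Set.range s)) (φ : Intertwiner s s' →₀ H) :
    transfer s' x (intertwinerSum s s' φ) =
      intertwinerSum s s' (amplify _ (GeneratedAlgebra.val _ x) φ) :=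
  LinearMap.extendOfNorm_eq hd ⟨‖x‖, norm_intertwinerSum_amplify_le x⟩ φ

theorem ext_of_intertwinerSum (hd : DenseRange (intertwinerSum s s'))
    {f g : K →L[ℂ] K}
    (h : ∀ φ, f (intertwinerSum s s' φ) = g (intertwinerSum s s' φ)) : f = g :=
  DFunLike.coe_injective (hd.equalizer f.continuous g.continuous (funext h))

/-- `transfer` as a `*`-homomorphism. -/
noncomputable def transferHom (hd : DenseRange (intertwinerSum s s')) :
    GeneratedAlgebra (Set.range s) →⋆ₐ[ℂ] (K →L[ℂ] K) where
  toFun := transfer s'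
  map_one' := ext_of_intertwinerSum hd fun φ => by
    rw [transfer_apply hd, map_one, amplify_one]; rfl
  map_mul' x y := ext_of_intertwinerSum hd fun φ => by
    rw [mul_apply_eq_comp, transfer_apply hd, transfer_apply hd, transfer_apply hd,
      map_mul, amplify_mul]
  map_zero' := ext_of_intertwinerSum hd fun φ => by
    rw [transfer_apply hd, map_zero, ← zero_smul ℂ (1 : H →L[ℂ] H), amplify_smul]; simp
  map_add' x y := ext_of_intertwinerSum hd fun φ => by
    rw [add_apply, transfer_apply hd, transfer_apply hd, transfer_apply hd, map_add, amplify_add,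
      map_add]
  commutes' r := ext_of_intertwinerSum hd fun φ => by
    rw [transfer_apply hd, Algebra.algebraMap_eq_smul_one, Algebra.algebraMap_eq_smul_one, map_smul,
      map_one, amplify_smul, amplify_one]
    simp
  map_star' x := by
    rw [ContinuousLinearMap.star_eq_adjoint, ContinuousLinearMap.eq_adjoint_iff]
    intro ξ η
    refine hd.induction_on₂ (p := fun ξ η => ⟪transfer s' (star x) ξ, η⟫_ℂ = ⟪ξ, transfer s' x η⟫_ℂ)
      ?_ (fun φ ψ => ?_) ξ η
    · exact isClosed_eq (by fun_prop) (by fun_prop)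
    · rw [transfer_apply hd, transfer_apply hd, map_star]
      exact inner_amplify x.val_mem φ ψ

theorem transferHom_apply (hd : DenseRange (intertwinerSum s s'))
    (x : GeneratedAlgebra (Set.range s)) : transferHom hd x = transfer s' x :=
  rfl

theorem transferHom_generator (hd : DenseRange (intertwinerSum s s'))
    {x : GeneratedAlgebra (Set.range s)} {j : J}
    (hx : GeneratedAlgebra.val _ x = s j) : transferHom hd x = s' j := by
  refine ext_of_intertwinerSum hd fun φ => ?_
  rw [transferHom_apply, transfer_apply hd, hx]
  induction φ using Finsupp.induction_linear with
  | zero => simp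
  | add φ ψ h h' => simp only [map_add, h, h']
  | single W a =>
    rw [amplify_single, intertwinerSum_single, intertwinerSum_single]
    exact DFunLike.congr_fun (W.2 j).1 a

/-- Pulling back ultraweakly continuous functionals along `transferHom`. -/
theorem exists_predual_transferHom (hd : DenseRange (intertwinerSum s s'))
    {ω : StrongDual ℂ (K →L[ℂ] K)} (hω : ω ∈ ultraweakDual K) :
    ∃ p ∈ restrictedDual (Set.range s), ∀ x, p x = ω (transferHom hd x) := by
  let Tlin : GeneratedAlgebra (Set.range s) →ₗ[ℂ] (K →L[ℂ] K) :=
    (transferHom hd).toAlgHom.toLinearMap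
  let T : GeneratedAlgebra (Set.range s) →L[ℂ] (K →L[ℂ] K) :=
    Tlin.mkContinuous 1 fun x => by
      rw [one_mul]; exact NonUnitalStarAlgHom.norm_apply_le (transferHom hd) x
  have hT (x) : T x = transferHom hd x := rfl
  refine ⟨ω.comp T, ?_, fun x => rfl⟩
  have hclosed : IsClosed (restrictedDual (Set.range s) :
      Set (StrongDual ℂ (GeneratedAlgebra (Set.range s)))) :=
    Submodule.isClosed_topologicalClosure _
  have hcont : Continuous fun ω : StrongDual ℂ (K →L[ℂ] K) => ω.comp T := by fun_prop
  refine closure_minimal ?_ (hclosed.preimage hcont) hω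
  intro ω hω
  show ω.comp T ∈ restrictedDual _
  induction hω using Submodule.span_induction with
  | zero => rw [ContinuousLinearMap.zero_comp]; exact zero_mem _
  | add x y _ _ hx hy => rw [ContinuousLinearMap.add_comp]; exact add_mem hx hy
  | smul c x _ hx => rw [ContinuousLinearMap.smul_comp]; exact Submodule.smul_mem _ c hx
  | mem ω h =>
    obtain ⟨⟨ξ, η⟩, rfl⟩ := h
    -- The target is norm closed and vector functionals depend continuously on their vectors, so
    -- sums of values of intertwiners suffice, and by sesquilinearity single values `W a`, `W' b`.
    have hv : Continuous fun p : K × K => (vectorFunctional K p.1 p.2).comp T := by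
      unfold vectorFunctional
      fun_prop
    refine hd.induction_on₂ (p := fun ξ η => (vectorFunctional K ξ η).comp T ∈ restrictedDual _)
      (hclosed.preimage hv) (fun φ ψ => ?_) ξ η
    induction φ using Finsupp.induction_linear with
    | zero =>
      have : (vectorFunctional K (intertwinerSum s s' 0) (intertwinerSum s s' ψ)).comp T = 0 := by
        ext x; simp [vectorFunctional]
      rw [this]; exact zero_mem _
    | add φ φ' h h' =>
      have : (vectorFunctional K (intertwinerSum s s' (φ + φ')) (intertwinerSum s s' ψ)).comp T =
          (vectorFunctional K (intertwinerSum s s' φ) (intertwinerSum s s' ψ)).comp T +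
          (vectorFunctional K (intertwinerSum s s' φ') (intertwinerSum s s' ψ)).comp T := by
        ext x; simp [vectorFunctional]
      rw [this]; exact add_mem h h'
    | single W a =>
      induction ψ using Finsupp.induction_linear with
      | zero =>
        have : (vectorFunctional K (intertwinerSum s s' (Finsupp.single W a))
            (intertwinerSum s s' 0)).comp T = 0 := by
          ext x; simp [vectorFunctional]
        rw [this]; exact zero_mem _
      | add ψ ψ' h h' =>
        have : (vectorFunctional K (intertwinerSum s s' (Finsupp.single W a))
              (intertwinerSum s s' (ψ + ψ'))).comp T =
            (vectorFunctional K (intertwinerSum s s' (Finsupp.single W a))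
              (intertwinerSum s s' ψ)).comp T +
            (vectorFunctional K (intertwinerSum s s' (Finsupp.single W a))
              (intertwinerSum s s' ψ')).comp T := by
          ext x; simp [vectorFunctional]
        rw [this]; exact add_mem h h'
      | single W' b =>
        have : (vectorFunctional K (intertwinerSum s s' (Finsupp.single W a))
              (intertwinerSum s s' (Finsupp.single W' b))).comp T =
            restrictDual _ (vectorFunctional H a (W.1.adjoint (W'.1 b))) := by
          ext x
          show ⟪_, transferHom hd x _⟫_ℂ = ⟪_, GeneratedAlgebra.val _ x a⟫_ℂ
          rw [transferHom_apply, transfer_apply hd, amplify_single, intertwinerSum_single,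
            intertwinerSum_single, ContinuousLinearMap.adjoint_inner_left]
        rw [this]
        exact restrictDual_mem _ (vectorFunctional_mem _ _)

/-- By the bipolar description: a normal functional vanishing on the `*`-algebra of `S'` pulls back
to a normal functional vanishing on the `*`-algebra of the `s j`, hence to zero. -/
theorem transferHom_mem (hd : DenseRange (intertwinerSum s s')) {S' : Set (K →L[ℂ] K)}
    (hS' : ∀ j, s' j ∈ S') (x : GeneratedAlgebra (Set.range s)) :
    transferHom hd x ∈ wstarAdjoin S' := by
  rw [mem_wstarAdjoin_iff]
  intro ω hω h
  obtain ⟨p, hp, hpω⟩ := exists_predual_transferHom hd hω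
  rw [← hpω, eq_zero_of_vanish_adjoin hp fun y hy => ?_, zero_apply]
  rw [hpω]
  refine h _ (mem_of_val_mem_adjoin ((StarAlgebra.adjoin ℂ S').comap (transferHom hd))
    (fun z hz => ?_) hy)
  obtain ⟨j, hj⟩ := hz
  show transferHom hd z ∈ StarAlgebra.adjoin ℂ S'
  rw [transferHom_generator hd hj.symm]
  exact StarAlgebra.subset_adjoin ℂ _ (hS' j)

/-- If the ranges of the intertwiners of two families of operators are total, then there is a normal
homomorphism between the generated `W*`-algebras that maps generators to generators. -/
theorem exists_generated_hom (hd : DenseRange (intertwinerSum s s'))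
    {S' : Set (K →L[ℂ] K)} (hS' : ∀ j, s' j ∈ S') :
    ∃ T : generated (Set.range s) ⟶ generated S',
      ∀ (x : GeneratedAlgebra (Set.range s)) (j : J), GeneratedAlgebra.val _ x = s j →
        GeneratedAlgebra.val _ (T x) = s' j := by
  let T : GeneratedAlgebra (Set.range s) →⋆ₐ[ℂ] GeneratedAlgebra S' :=
    StarAlgHom.codRestrict (transferHom hd) (wstarAdjoin S') (transferHom_mem hd hS')
  have normal : @Continuous _ _ (generated (Set.range s)).wstarTopology
      (generated S').wstarTopology T := by
    refine (normal_iff (M := generated (Set.range s)) (N := generated S') T).mpr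
      fun p => ?_
    obtain ⟨ω, hω, hωp⟩ := exists_restrictDual_eq p.2
    obtain ⟨q, hq, hqω⟩ := exists_predual_transferHom hd hω
    exact ⟨⟨q, hq⟩, fun x => (DFunLike.congr_fun hωp (T x)).symm.trans (hqω x).symm⟩
  exact ⟨⟨T, normal⟩, fun x j hx => transferHom_generator hd hx⟩

end Transfer

end Intertwiners

/-! ### Functoriality of the spatial tensor product -/

section TensorOp

variable {H H' K : Type u} [NormedAddCommGroup H] [InnerProductSpace ℂ H]
  [NormedAddCommGroup H'] [InnerProductSpace ℂ H'] [NormedAddCommGroup K] [InnerProductSpace ℂ K]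

/-- The operator `W ⊗ 1`. -/
noncomputable def tensorOne (K : Type u) [NormedAddCommGroup K] [InnerProductSpace ℂ K]
    (W : H →L[ℂ] H') : HilbertTensor H K →L[ℂ] HilbertTensor H' K :=
  (TensorProduct.mapL W (ContinuousLinearMap.id ℂ K)).completion

theorem tensorOne_tmul (W : H →L[ℂ] H') (ξ : H) (η : K) :
    tensorOne K W ((ξ ⊗ₜ[ℂ] η : H ⊗[ℂ] K) : HilbertTensor H K) =
      ((W ξ ⊗ₜ[ℂ] η : H' ⊗[ℂ] K) : HilbertTensor H' K) := by
  simp [tensorOne]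

theorem tensorOp_tmul (a : H →L[ℂ] H) (b : K →L[ℂ] K) (ξ : H) (η : K) :
    tensorOp a b ((ξ ⊗ₜ[ℂ] η : H ⊗[ℂ] K) : HilbertTensor H K) =
      ((a ξ ⊗ₜ[ℂ] b η : H ⊗[ℂ] K) : HilbertTensor H K) := by
  simp [tensorOp]

theorem hilbertTensor_ext {G : Type*} [NormedAddCommGroup G] [NormedSpace ℂ G]
    {f g : HilbertTensor H K →L[ℂ] G}
    (h : ∀ (ξ : H) (η : K), f ((ξ ⊗ₜ[ℂ] η : H ⊗[ℂ] K) : HilbertTensor H K) =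
      g ((ξ ⊗ₜ[ℂ] η : H ⊗[ℂ] K) : HilbertTensor H K)) : f = g := by
  ext v
  induction v using UniformSpace.Completion.induction_on with
  | hp => exact isClosed_eq f.continuous g.continuous
  | ih v =>
    induction v using TensorProduct.induction_on with
    | zero => simpa only [TensorProduct.zero_tmul] using h 0 0
    | tmul ξ η => exact h ξ η
    | add v w hv hw => simp only [UniformSpace.Completion.coe_add, map_add, hv, hw]

theorem tensorOne_comp_tensorOp {W : H →L[ℂ] H'} {a : H →L[ℂ] H} {a' : H' →L[ℂ] H'}
    (h : W ∘L a = a' ∘L W) (b : K →L[ℂ] K) :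
    tensorOne K W ∘L tensorOp a b = tensorOp a' b ∘L tensorOne K W := by
  refine hilbertTensor_ext fun ξ η => ?_
  rw [ContinuousLinearMap.comp_apply, ContinuousLinearMap.comp_apply, tensorOp_tmul, tensorOne_tmul,
    tensorOne_tmul, tensorOp_tmul, ← ContinuousLinearMap.comp_apply W, h]
  rfl

theorem star_tensorOp [CompleteSpace H] [CompleteSpace K] (a : H →L[ℂ] H) (b : K →L[ℂ] K) :
    star (tensorOp a b) = tensorOp (star a) (star b) := by
  rw [ContinuousLinearMap.star_eq_adjoint, eq_comm, ContinuousLinearMap.eq_adjoint_iff]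
  intro v w
  induction v, w using UniformSpace.Completion.induction_on₂ with
  | hp => exact isClosed_eq (by fun_prop) (by fun_prop)
  | ih v w =>
    induction v using TensorProduct.induction_on with
    | zero => rw [UniformSpace.Completion.coe_zero, map_zero, inner_zero_left, inner_zero_left]
    | add v v' hv hv' =>
      simp only [UniformSpace.Completion.coe_add, map_add, inner_add_left, hv, hv']
    | tmul ξ η =>
      induction w using TensorProduct.induction_on with
      | zero => rw [UniformSpace.Completion.coe_zero, map_zero, inner_zero_right, inner_zero_right]
      | add w w' hw hw' =>
        simp only [UniformSpace.Completion.coe_add, map_add, inner_add_right, hw, hw']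
      | tmul ξ' η' =>
        rw [tensorOp_tmul, tensorOp_tmul]
        simp [ContinuousLinearMap.star_eq_adjoint, ContinuousLinearMap.adjoint_inner_left]

end TensorOp

/-! ### Intertwiners of universal representations -/

section Universal

variable {M M' : WStarAlg.{u}} (f : M ⟶ M')

/-- The positive functional `x ↦ φ (y* f(x) y)`. -/
noncomputable def pullbackPositive (φ : M' →ₚ[ℂ] ℂ) (y : M') : M →ₚ[ℂ] ℂ :=
  PositiveLinearMap.mk₀
    { toFun := fun x => φ (star y * f x * y)
      map_add' := fun a b => by rw [map_add, mul_add, add_mul, map_add]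
      map_smul' := fun c a => by
        rw [map_smul, mul_smul_comm, smul_mul_assoc, map_smul, RingHom.id_apply] }
    fun x hx => by
      obtain ⟨z, rfl⟩ := CStarAlgebra.nonneg_iff_eq_star_mul_self.mp hx
      show 0 ≤ φ (star y * f (star z * z) * y)
      have : star y * f (star z * z) * y = star (f z * y) * (f z * y) := by
        rw [map_mul, map_star, star_mul]; simp only [mul_assoc]
      rw [this]
      exact φ.map_nonneg (star_mul_self_nonneg _)

theorem pullbackPositive_apply (φ : M' →ₚ[ℂ] ℂ) (y : M') (x : M) :
    pullbackPositive f φ y x = φ (star y * f x * y) := rfl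

/-- Separate `w*`-continuity of multiplication enters here: `φ (y* · y)` is again in the predual,
and normality of `f` pulls it back. -/
theorem exists_predual_pullbackPositive (φ : NormalState M') (y : M') :
    ∃ p : M.Predual, ∀ x, pullbackPositive f φ.toPositive y x = M.dualEquiv x p := by
  obtain ⟨p, hp⟩ := φ.normal
  obtain ⟨q, hq⟩ := exists_predual_conj M'.dualEquiv y p
  obtain ⟨r, hr⟩ := (normal_iff f.toStarAlgHom).mp f.normal q
  exact ⟨r, fun x => by rw [pullbackPositive_apply, hp, ← hq, hr]⟩

/-- A positive functional that is a nonnegative multiple of a normal state `ψ` through `f` gives an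
intertwiner between Gelfand-Naimark-Segal spaces. -/
theorem exists_gns_intertwiner (φ : M' →ₚ[ℂ] ℂ) (y : M') (ψ : M →ₚ[ℂ] ℂ) {c : ℝ} (hc : 0 ≤ c)
    (h : ∀ x, pullbackPositive f φ y x = c * ψ x) :
    ∃ V : ψ.GNS →L[ℂ] φ.GNS, V ((ψ.toPreGNS 1 : ψ.PreGNS) : ψ.GNS) = (φ.toPreGNS y : φ.GNS) ∧
      ∀ x, V ∘L ψ.gnsStarAlgHom x = φ.gnsStarAlgHom (f x) ∘L V := by
  -- The class of `x` goes to that of `f(x) y`, whose squared norm is `φ (y* f(x* x) y) = c ψ(x*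
  -- x)`; so the map is `√c` times an isometry.
  let V₀ : ψ.PreGNS →ₗ[ℂ] φ.PreGNS :=
    { toFun := fun x => φ.toPreGNS (f (ψ.ofPreGNS x) * y)
      map_add' := fun a b => by rw [map_add, map_add, add_mul, map_add]
      map_smul' := fun r a => by
        rw [map_smul, map_smul, smul_mul_assoc, map_smul, RingHom.id_apply] }
  have hV₀ (x) : V₀ x = φ.toPreGNS (f (ψ.ofPreGNS x) * y) := rfl
  have bound (x : ψ.PreGNS) : ‖V₀ x‖ ≤ √c * ‖x‖ := by
    refine le_of_sq_le_sq (le_of_eq ?_) (by positivity)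
    have h1 := φ.preGNS_norm_sq (V₀ x)
    have h2 := ψ.preGNS_norm_sq x
    rw [hV₀, PositiveLinearMap.ofPreGNS_toPreGNS] at h1
    have h3 := h (star (ψ.ofPreGNS x) * ψ.ofPreGNS x)
    have h5 : f (star (ψ.ofPreGNS x) * ψ.ofPreGNS x) =
        star (f (ψ.ofPreGNS x)) * f (ψ.ofPreGNS x) := by rw [map_mul, map_star]
    rw [pullbackPositive_apply, ← h2, h5] at h3
    have h4 : star (f (ψ.ofPreGNS x) * y) * (f (ψ.ofPreGNS x) * y) =
        star y * (star (f (ψ.ofPreGNS x)) * f (ψ.ofPreGNS x)) * y := by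
      rw [star_mul]; simp only [mul_assoc]
    rw [h4, h3] at h1
    rw [mul_pow, Real.sq_sqrt hc]
    exact_mod_cast h1
  let V₁ : ψ.PreGNS →L[ℂ] φ.PreGNS := V₀.mkContinuous (√c) bound
  have hV₁ (x) : V₁ x = φ.toPreGNS (f (ψ.ofPreGNS x) * y) := rfl
  refine ⟨V₁.completion, ?_, fun x => ?_⟩
  · rw [ContinuousLinearMap.completion_apply_coe, hV₁]
    simp
  · ext v
    induction v using UniformSpace.Completion.induction_on with
    | hp => exact isClosed_eq (by fun_prop) (by fun_prop)
    | ih v =>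
      simp [hV₁, mul_assoc]

/-- The vector of the universal space that is given by a normal state and an element. -/
noncomputable def universalVector (φ : NormalState M') (y : M') : UniversalSpace M' :=
  open scoped Classical in
  lp.single (E := fun φ : NormalState M' => φ.toPositive.GNS) 2 φ
    ((φ.toPositive.toPreGNS y : φ.toPositive.PreGNS) : φ.toPositive.GNS)

/-- Divide `φ (y* f(·) y)` by `c = φ (y* y)` to get a normal state `ψ` of `M`; then project to the
summand of `ψ`, apply the GNS intertwiner and include into the summand of `φ`. -/
theorem exists_universal_intertwiner (φ : NormalState M') (y : M') :
    ∃ (W : UniversalSpace M →L[ℂ] UniversalSpace M') (v : UniversalSpace M),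
      (∀ x, W ∘L universalRep M x = universalRep M' (f x) ∘L W) ∧ W v = universalVector φ y := by
  classical
  have hnn : 0 ≤ φ.toPositive (star y * y) := φ.toPositive.map_nonneg (star_mul_self_nonneg y)
  obtain ⟨c, hc, hcy⟩ : ∃ c : ℝ, 0 ≤ c ∧ φ.toPositive (star y * y) = c :=
    ⟨_, (Complex.nonneg_iff.mp hnn).1, Complex.ext rfl (Complex.nonneg_iff.mp hnn).2.symm⟩
  -- If `c = 0` no state arises, but then the vector of `y` is zero and the zero intertwiner serves.
  rcases hc.eq_or_lt with rfl | hpos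
  · refine ⟨0, 0, fun x => by simp, ?_⟩
    have h0 : ‖((φ.toPositive.toPreGNS y : φ.toPositive.PreGNS) : φ.toPositive.GNS)‖ = 0 := by
      have := φ.toPositive.preGNS_norm_sq (φ.toPositive.toPreGNS y)
      rw [PositiveLinearMap.ofPreGNS_toPreGNS, hcy] at this
      rw [UniformSpace.Completion.norm_coe]
      simpa using this
    rw [universalVector, norm_eq_zero.mp h0]
    simp
  · have hcne : (c : ℂ) ≠ 0 := by exact_mod_cast hpos.ne'
    let ψ' : M →ₚ[ℂ] ℂ := PositiveLinearMap.mk₀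
      ((c : ℂ)⁻¹ • (pullbackPositive f φ.toPositive y).toLinearMap) fun x hx =>
        mul_nonneg (by rw [← Complex.ofReal_inv]; exact_mod_cast inv_nonneg.mpr hc)
          ((pullbackPositive f φ.toPositive y).map_nonneg hx)
    have hψ' (x) : ψ' x = (c : ℂ)⁻¹ * pullbackPositive f φ.toPositive y x := rfl
    obtain ⟨p, hp⟩ := exists_predual_pullbackPositive f φ y
    let ψ : NormalState M :=
      { toPositive := ψ'
        map_one := by
          rw [hψ', pullbackPositive_apply, map_one, mul_one, hcy, inv_mul_cancel₀ hcne]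
        normal := ⟨(c : ℂ)⁻¹ • p, fun x => by rw [hψ', hp, map_smul, smul_eq_mul]⟩ }
    obtain ⟨V, hV1, hV⟩ := exists_gns_intertwiner f φ.toPositive y ψ' hc
      fun x => by rw [hψ', mul_inv_cancel_left₀ hcne]
    refine ⟨(lp.singleContinuousLinearMap ℂ (fun φ : NormalState M' => φ.toPositive.GNS) 2 φ) ∘L V ∘L
      (lp.evalCLM ℂ (fun φ : NormalState M => φ.toPositive.GNS) 2 ψ), universalVector ψ 1,
      fun x => ?_, ?_⟩
    · ext v θ
      have h := DFunLike.congr_fun (hV x) (v ψ)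
      simp only [ContinuousLinearMap.comp_apply, universalRep_apply] at h ⊢
      show lp.single (E := fun φ : NormalState M' => φ.toPositive.GNS) 2 φ
          (V (universalRep M x v ψ)) θ = θ.toPositive.gnsStarAlgHom (f x)
            (lp.single (E := fun φ : NormalState M' => φ.toPositive.GNS) 2 φ (V (v ψ)) θ)
      have h' : V (universalRep M x v ψ) = φ.toPositive.gnsStarAlgHom (f x) (V (v ψ)) := h
      rw [h', lp.single_apply, lp.single_apply]
      rcases eq_or_ne θ φ with rfl | hne
      · rw [Pi.single_eq_same, Pi.single_eq_same]
      · rw [Pi.single_eq_of_ne hne, Pi.single_eq_of_ne hne, map_zero]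
    · show lp.single (E := fun φ : NormalState M' => φ.toPositive.GNS) 2 φ
        (V (universalVector ψ 1 ψ)) = _
      have h1 : universalVector ψ 1 ψ =
          ((ψ'.toPreGNS 1 : ψ'.PreGNS) : ψ'.GNS) := by
        rw [universalVector, lp.single_apply, Pi.single_eq_same]
      rw [h1, hV1, universalVector]

variable {N : WStarAlg.{u}}

theorem star_elementary (m : M) (n : N) :
    star (elementary M N m n) = elementary M N (star m) (star n) := by
  rw [elementary, star_tensorOp, ← map_star, ← map_star]
  rfl

/-- The intertwiner `W ⊗ 1` of the elementary tensors. -/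
noncomputable def tensorIntertwiner (N : WStarAlg.{u})
    {W : UniversalSpace M →L[ℂ] UniversalSpace M'}
    (hW : ∀ x, W ∘L universalRep M x = universalRep M' (f x) ∘L W) :
    Intertwiner (fun p : M × N => elementary M N p.1 p.2)
      (fun p : M × N => elementary M' N (f p.1) p.2) :=
  ⟨tensorOne (UniversalSpace N) W, fun p => by
    have key (m : M) (n : N) : tensorOne (UniversalSpace N) W ∘L elementary M N m n =
        elementary M' N (f m) n ∘L tensorOne (UniversalSpace N) W :=
      tensorOne_comp_tensorOp (hW m) _
    refine ⟨key p.1 p.2, ?_⟩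
    rw [star_elementary, star_elementary, ← map_star]
    exact key (star p.1) (star p.2)⟩

theorem span_universalVector_dense (L : Submodule ℂ (UniversalSpace M'))
    (hL : IsClosed (L : Set (UniversalSpace M')))
    (h : ∀ (φ : NormalState M') (y : M'), universalVector φ y ∈ L) (v : UniversalSpace M') :
    v ∈ L := by
  classical
  have hs := lp.hasSum_single ENNReal.ofNat_ne_top v
  refine hL.mem_of_tendsto hs (Filter.Eventually.of_forall fun t => L.sum_mem fun φ _ => ?_)
  suffices ∀ ξ : φ.toPositive.GNS,
      lp.singleContinuousLinearMap ℂ (fun φ : NormalState M' => φ.toPositive.GNS) 2 φ ξ ∈ L from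
    this (v φ)
  intro ξ
  induction ξ using UniformSpace.Completion.induction_on with
  | hp => exact hL.preimage (ContinuousLinearMap.continuous _)
  | ih ξ =>
    have := h φ (φ.toPositive.ofPreGNS ξ)
    rw [universalVector] at this
    convert this
    rw [lp.singleContinuousLinearMap_apply]
    congr!

/-- For fixed `η`, the vectors `v` with `v ⊗ η` in the closed range form a closed subspace
containing every universal vector `W w`, since `W w ⊗ η = (W ⊗ 1)(w ⊗ η)`. -/
theorem denseRange_intertwinerSum :
    DenseRange (intertwinerSum (fun p : M × N => elementary M N p.1 p.2)
      (fun p : M × N => elementary M' N (f p.1) p.2)) := by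
  set A := intertwinerSum (fun p : M × N => elementary M N p.1 p.2)
      (fun p : M × N => elementary M' N (f p.1) p.2) with hA
  let R := A.range.topologicalClosure
  have hR : IsClosed (R : Set (HilbertTensor (UniversalSpace M') (UniversalSpace N))) :=
    A.range.isClosed_topologicalClosure
  have pure (v : UniversalSpace M') (η : UniversalSpace N) :
      ((v ⊗ₜ[ℂ] η : UniversalSpace M' ⊗[ℂ] UniversalSpace N) :
        HilbertTensor (UniversalSpace M') (UniversalSpace N)) ∈ R := by
    let B : UniversalSpace M' →L[ℂ] HilbertTensor (UniversalSpace M') (UniversalSpace N) :=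
      UniformSpace.Completion.toComplL ∘L
        (TensorProduct.mkL ℂ (UniversalSpace M') (UniversalSpace N)).flip η
    refine span_universalVector_dense (R.comap B.toLinearMap) (hR.preimage B.continuous)
      (fun φ y => ?_) v
    obtain ⟨W, w, hW, hWw⟩ := exists_universal_intertwiner f φ y
    refine Submodule.le_topologicalClosure _ ⟨Finsupp.single (tensorIntertwiner f N hW)
      ((w ⊗ₜ[ℂ] η : UniversalSpace M ⊗[ℂ] UniversalSpace N) :
        HilbertTensor (UniversalSpace M) (UniversalSpace N)), ?_⟩
    rw [hA, intertwinerSum_single]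
    refine (tensorOne_tmul W w η).trans ?_
    rw [hWw]
    rfl
  intro v
  show v ∈ R
  induction v using UniformSpace.Completion.induction_on with
  | hp => exact hR
  | ih v =>
    induction v using TensorProduct.induction_on with
    | zero => rw [UniformSpace.Completion.coe_zero]; exact zero_mem _
    | tmul ξ η => exact pure ξ η
    | add v w hv hw => rw [UniformSpace.Completion.coe_add]; exact add_mem hv hw

end Universal

/-- The tensor product of a morphism with an identity exists. -/
theorem exists_isTensorHom {M M' : WStarAlg.{u}} (f : M ⟶ M') (N : WStarAlg.{u}) :
    ∃ T : tensor M N ⟶ tensor M' N, IsTensorHom f (𝟙 N) T := by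
  obtain ⟨T, hT⟩ := exists_generated_hom (denseRange_intertwinerSum f (N := N))
    (S' := Set.range fun p : M' × N => elementary M' N p.1 p.2) fun p => ⟨(f p.1, p.2), rfl⟩
  exact ⟨T, fun m n => Subtype.ext (hT (tmul m n) (m, n) rfl)⟩

/-- The tensor product of two morphisms is unique. -/
theorem IsTensorHom.unique {M M' N N' : WStarAlg.{u}} {f : M ⟶ M'} {g : N ⟶ N'}
    {T T' : tensor M N ⟶ tensor M' N'} (h : IsTensorHom f g T) (h' : IsTensorHom f g T') :
    T = T' := by
  refine generated_hom_ext fun x hx => ?_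
  obtain ⟨⟨m, n⟩, hmn⟩ := hx
  have hx : x = tmul m n := Subtype.ext hmn.symm
  rw [hx]
  exact (h m n).trans (h' m n).symm

theorem IsTensorHom.comp {M M' M'' N N' N'' : WStarAlg.{u}} {f : M ⟶ M'} {g : N ⟶ N'}
    {f' : M' ⟶ M''} {g' : N' ⟶ N''} {T : tensor M N ⟶ tensor M' N'}
    {T' : tensor M' N' ⟶ tensor M'' N''} (h : IsTensorHom f g T) (h' : IsTensorHom f' g' T') :
    IsTensorHom (f ≫ f') (g ≫ g') (T ≫ T') := fun m n => by
  show T' (T (tmul m n)) = tmul (f' (f m)) (g' (g n))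
  rw [h, h']

/-! ### Free products and free exponentials -/

theorem isFreeProduct_iff {I : Type u} {M : I → WStarAlg.{u}} {P : WStarAlg.{u}}
    {ι : ∀ a, M a ⟶ P} :
    IsFreeProduct M P ι ↔ ∀ (R : WStarAlg.{u}) (f : ∀ a, M a ⟶ R), ∃! g : P ⟶ R, ∀ a, ι a ≫ g = f a := by
  constructor
  · rintro ⟨h⟩ R f
    refine ⟨Limits.Cofan.IsColimit.desc h f, fun a => Limits.Cofan.IsColimit.fac h f a,
      fun g hg => Limits.Cofan.IsColimit.hom_ext h _ _ fun a => ?_⟩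
    exact (hg a).trans (Limits.Cofan.IsColimit.fac h f a).symm
  · intro h
    choose d hd huniq using fun t : Limits.Cofan M => h t.pt t.inj
    exact ⟨Limits.Cofan.IsColimit.mk _ d (fun t a => hd t a) fun t m hm => huniq t m hm⟩

/-! ### Exchanging free products and free exponentials -/

variable {I : Type u} {M : I → WStarAlg.{u}} {N P : WStarAlg.{u}} {ι : ∀ a, M a ⟶ P}
  {E : I → WStarAlg.{u}} {ε : ∀ a, M a ⟶ tensor (E a) N}

theorem IsFreeExponentialMap.comp_factor {A A' B B' R : WStarAlg.{u}} {ε : A ⟶ tensor B N}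
    {ε' : A' ⟶ tensor B' N} {f : A ⟶ A'} {σ : B ⟶ B'} (h : IsFreeExponentialMap ε ε' f σ)
    {ρ : B' ⟶ R} {T : tensor B' N ⟶ tensor R N} (hT : IsTensorHom ρ (𝟙 N) T) :
    ∃ S : tensor B N ⟶ tensor R N, IsTensorHom (σ ≫ ρ) (𝟙 N) S ∧ ε ≫ S = f ≫ ε' ≫ T := by
  obtain ⟨U, hU, hUε⟩ := h
  refine ⟨U ≫ T, ?_, ?_⟩
  · simpa using hU.comp hT
  · rw [← Category.assoc, hUε, Category.assoc]

/-- The induced morphisms exhibit a free exponential of a free product as a free product. -/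
theorem IsFreeExponential.isFreeProduct (hP : IsFreeProduct M P ι)
    (hE : ∀ a, IsFreeExponential (M a) N (E a) (ε a)) {F : WStarAlg.{u}} {εF : P ⟶ tensor F N}
    (hF : IsFreeExponential P N F εF) {σ : ∀ a, E a ⟶ F}
    (hσ : ∀ a, IsFreeExponentialMap (ε a) εF (ι a) (σ a)) : IsFreeProduct E F σ := by
  rw [isFreeProduct_iff] at hP ⊢
  intro R f
  choose T hT using fun a => exists_isTensorHom (f a) N
  obtain ⟨π, hπ, hπu⟩ := hP _ fun a => ε a ≫ T a
  -- Both sides encode `ρ` by the same data on the `M a`. Forward uses uniqueness for the coproduct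
  -- `P`, backward uniqueness for each `E a`; the universal property of `F` then transfers.
  have hρ_iff (ρ : F ⟶ R) : (∀ a, σ a ≫ ρ = f a) ↔
      ∃ S : tensor F N ⟶ tensor R N, IsTensorHom ρ (𝟙 N) S ∧ εF ≫ S = π := by
    constructor
    · intro h
      obtain ⟨S, hS⟩ := exists_isTensorHom ρ N
      refine ⟨S, hS, hπu _ fun a => ?_⟩
      obtain ⟨U, hU, hUε⟩ := (hσ a).comp_factor hS
      rw [h a] at hU
      rw [← hUε, hU.unique (hT a)]
    · rintro ⟨S, hS, hSπ⟩ a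
      obtain ⟨U, hU, hUε⟩ := (hσ a).comp_factor hS
      refine (hE a R (ε a ≫ T a)).unique ⟨U, hU, ?_⟩ ⟨T a, hT a, rfl⟩
      rw [hUε, hSπ, hπ]
  simpa only [hρ_iff] using hF R π

/-- A free product of free exponentials is a free exponential of the free product. -/
theorem IsFreeProduct.isFreeExponential (hP : IsFreeProduct M P ι)
    (hE : ∀ a, IsFreeExponential (M a) N (E a) (ε a)) {Q : WStarAlg.{u}} {κ : ∀ a, E a ⟶ Q}
    (hQ : IsFreeProduct E Q κ) {δ : P ⟶ tensor Q N}
    (hδ : ∀ a, IsFreeExponentialMap (ε a) δ (ι a) (κ a)) : IsFreeExponential P N Q δ := by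
  rw [isFreeProduct_iff] at hP hQ
  intro R π
  choose f hf hfu using fun a => hE a R (ι a ≫ π)
  -- The same dictionary, now with the universal property of `Q` known and that of the exponential
  -- sought.
  have hρ_iff (ρ : Q ⟶ R) : (∃ S : tensor Q N ⟶ tensor R N, IsTensorHom ρ (𝟙 N) S ∧ δ ≫ S = π) ↔
      ∀ a, κ a ≫ ρ = f a := by
    constructor
    · rintro ⟨S, hS, rfl⟩ a
      exact hfu a _ ((hδ a).comp_factor hS)
    · intro h
      obtain ⟨S, hS⟩ := exists_isTensorHom ρ N
      refine ⟨S, hS, (hP _ fun a => ι a ≫ π).unique (fun a => ?_) fun a => rfl⟩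
      obtain ⟨U, hU, hUε⟩ := (hδ a).comp_factor hS
      obtain ⟨T, hT, hTε⟩ := hf a
      rw [h a] at hU
      rw [← hUε, hU.unique hT, hTε]
  simpa only [hρ_iff] using hQ R f

theorem exists_isFreeExponentialMap_cofan (hP : IsFreeProduct M P ι) {Q : WStarAlg.{u}}
    (κ : ∀ a, E a ⟶ Q) : ∃ δ : P ⟶ tensor Q N, ∀ a, IsFreeExponentialMap (ε a) δ (ι a) (κ a) := by
  choose T hT using fun a => exists_isTensorHom (κ a) N
  obtain ⟨δ, hδ, -⟩ := isFreeProduct_iff.mp hP _ fun a => ε a ≫ T a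
  exact ⟨δ, fun a => ⟨T a, hT a, (hδ a).symm⟩⟩

theorem existsUnique_iso_of_isFreeProduct {F Q : WStarAlg.{u}} {σ : ∀ a, E a ⟶ F}
    {κ : ∀ a, E a ⟶ Q} (hF : IsFreeProduct E F σ) (hQ : IsFreeProduct E Q κ) :
    ∃! Φ : F ≅ Q, ∀ a, κ a ≫ Φ.inv = σ a := by
  rw [isFreeProduct_iff] at hF hQ
  obtain ⟨g, hg, -⟩ := hF Q κ
  obtain ⟨h, hh, hhu⟩ := hQ F σ
  refine ⟨⟨g, h, (hF F σ).unique (fun a => ?_) fun a => Category.comp_id _,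
    (hQ Q κ).unique (fun a => ?_) fun a => Category.comp_id _⟩, hh, fun Ψ hΨ => ?_⟩
  · rw [← Category.assoc, hg, hh]
  · rw [← Category.assoc, hh, hg]
  · exact Iso.ext_inv (hhu _ hΨ)

end WStar

theorem mainTheorem8 {I : Type u} (M : I → WStar.WStarAlg.{u}) (N : WStar.WStarAlg.{u})
    (P : WStar.WStarAlg.{u}) (ι : ∀ a, M a ⟶ P) (hP : WStar.IsFreeProduct M P ι)
    (E : I → WStar.WStarAlg.{u}) (ε : ∀ a, M a ⟶ WStar.tensor (E a) N)
    (hE : ∀ a, WStar.IsFreeExponential (M a) N (E a) (ε a)) :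
    -- the canonical isomorphism between the free exponential `F` of the free product and the
    -- free product `Q` of the free exponentials
    (∀ (F : WStar.WStarAlg.{u}) (εF : P ⟶ WStar.tensor F N)
        (Q : WStar.WStarAlg.{u}) (κ : ∀ a, E a ⟶ Q),
      WStar.IsFreeExponential P N F εF → WStar.IsFreeProduct E Q κ →
        ∃! Φ : F ≅ Q,
          ∀ a, WStar.IsFreeExponentialMap (ε a) εF (ι a) (κ a ≫ Φ.inv)) ∧
    -- every free exponential of the free product is a free product of the free exponentials
    (∀ (F : WStar.WStarAlg.{u}) (εF : P ⟶ WStar.tensor F N),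
      WStar.IsFreeExponential P N F εF →
        ∃ σ : ∀ a, E a ⟶ F,
          (∀ a, WStar.IsFreeExponentialMap (ε a) εF (ι a) (σ a)) ∧
            WStar.IsFreeProduct E F σ) ∧
    -- every free product of the free exponentials is a free exponential of the free product
    (∀ (Q : WStar.WStarAlg.{u}) (κ : ∀ a, E a ⟶ Q),
      WStar.IsFreeProduct E Q κ →
        ∃ δ : P ⟶ WStar.tensor Q N,
          (∀ a, WStar.IsFreeExponentialMap (ε a) δ (ι a) (κ a)) ∧
            WStar.IsFreeExponential P N Q δ) := by
  -- Being induced by `ι a` is literally the universal property of `E a` tested on `ι a ≫ εF`; `εF`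
  -- need not be universal.
  have induced (F : WStar.WStarAlg.{u}) (εF : P ⟶ WStar.tensor F N) (a : I) :
      ∃! σ : E a ⟶ F, WStar.IsFreeExponentialMap (ε a) εF (ι a) σ := hE a F (ι a ≫ εF)
  refine ⟨fun F εF Q κ hF hQ => ?_, fun F εF hF => ?_, fun Q κ hQ => ?_⟩
  · choose σ hσ hσu using induced F εF
    have h := WStar.existsUnique_iso_of_isFreeProduct (hF.isFreeProduct hP hE hσ) hQ
    -- Uniqueness of induced morphisms makes being equal to `σ a` the same as being induced by `ι
    -- a`.
    have key (Φ : F ≅ Q) : (∀ a, κ a ≫ Φ.inv = σ a) ↔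
        ∀ a, WStar.IsFreeExponentialMap (ε a) εF (ι a) (κ a ≫ Φ.inv) :=
      forall_congr' fun a => ⟨fun h => h ▸ hσ a, hσu a _⟩
    simpa only [key] using h
  · choose σ hσ _ using induced F εF
    exact ⟨σ, hσ, hF.isFreeProduct hP hE hσ⟩
  · obtain ⟨δ, hδ⟩ := WStar.exists_isFreeExponentialMap_cofan (ε := ε) hP κ
    exact ⟨δ, hδ, hP.isFreeExponential hE hQ hδ⟩
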